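/- Let $d\ge 1$, let $V,W\in L^\infty(\mathbb R^d)$ be real-valued, and let $\Lambda\subset\mathbb R^d$ be any (Lebesgue) measurable set, not necessarily bounded. Put $W_\Lambda(x,y)=\chi_\Lambda(x)\chi_\Lambda(y)\,W(x-y)$ and, for $\sigma>0$, $\varphi_x^\sigma(y)=(2\pi\sigma^2)^{-d/2}e^{-|y-x|^2/(2\sigma^2)}$. Let $\mathfrak F^-=\bigoplus_{n\ge 0}\mathfrak F_n^-$ be the fermionic Fock space over $L^2(\mathbb R^d)$, where $\mathfrak F_n^-\subset L^2(\mathbb R^{nd})$ is the subspace of antisymmetric functions, $P_n$ the orthogonal projection of $L^2(\mathbb R^{nd})$ onto $\mathfrak F_n^-$, and $a^*(f)$, $a(f)$ the creation and annihilation operators. For each $n$ and $\sigma>0$ the weakly convergent integral $$W_{\Lambda;n}^\sigma=\frac12\int_{\mathbb R^d}\int_{\mathbb R^d}W_\Lambda(x,y)\,a^*(\varphi_x^\sigma)a^*(\varphi_y^\sigma)a(\varphi_y^\sigma)a(\varphi_x^\sigma)\,dx\,dy$$ defines a bounded operator on $\mathfrak F_n^-$ (all matrix elements of the integrand are absolutely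 integrable, and their integrals are the matrix elements of $W_{\Lambda;n}^\sigma$). Let $W_{\Lambda;n}^0$ be the operator $\psi\mapsto P_n\big(\sum_{1\le k<l\le n}W_\Lambda(x_k,x_l)\,\psi\big)$ on $\mathfrak F_n^-$; if $W$ is even, this is simply multiplication by $\sum_{k<l}W_\Lambda(x_k,x_l)$. For $\sigma\ge 0$ let $H_{\Lambda;n}^\sigma=\sum_{k=1}^n(-\Delta_k+V(x_k))+W_{\Lambda;n}^\sigma$, with domain the antisymmetric functions in $H^2(\mathbb R^{nd})$, and let $H_\Lambda^\sigma=\bigoplus_{n\ge 0}H_{\Lambda;n}^\sigma$, with domain the set of all $(\psi_n)\in\mathfrak F^-$ such that each $\psi_n$ is in the domain of $H_{\Lambda;n}^\sigma$ and $\sum_n\|H_{\Lambda;n}^\sigma\psi_n\|^2<\infty$. Then $H_\Lambda^\sigma$ is self-adjoint for every $\sigma\ge 0$, and $H_\Lambda^\sigma\to H_\Lambda^0$ in the strong resolvent sense as $\sigma\downarrow 0$: for every $z\in\mathbb C\setminus\mathbb R$ and $\psi\in\mathfrak F^-$, $(H_\Lambda^\sigma-z)^{-1}\psi\to(H_\Lambda^0-z)^{-1}\psi$.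 -/

import Mathlib

open MeasureTheory Filter Topology

noncomputable section

namespace FermiGas

open scoped ENNReal SchwartzMap Laplacian InnerProductSpace

/-! ## Configuration space and the antisymmetric `n`-particle spaces -/

/-- One-particle configuration space `ℝ^d`. -/
abbrev Pos (d : ℕ) := EuclideanSpace ℝ (Fin d)

/-- `n`-particle configuration space `(ℝ^d)^n = ℝ^{nd}`, with its Euclidean norm and
Lebesgue measure. -/
abbrev Conf (d n : ℕ) := PiLp 2 (fun _ : Fin n => Pos d)

/-- The one-particle space `L²(ℝ^d)`. -/
abbrev OneParticle (d : ℕ) := Lp ℂ 2 (volume : Measure (Pos d))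

/-- `L²((ℝ^d)^n) = L²(ℝ^d)^{⊗n}`. -/
abbrev L2 (d n : ℕ) := Lp ℂ 2 (volume : Measure (Conf d n))

/-- Relabelling of the particles as a linear isometry of the configuration space:
`(x_1, …, x_n) ↦ (x_{π 1}, …, x_{π n})`. -/
def relabel (d : ℕ) {n : ℕ} (π : Equiv.Perm (Fin n)) : Conf d n ≃ₗᵢ[ℝ] Conf d n :=
  LinearIsometryEquiv.piLpCongrLeft 2 ℝ (Pos d) π.symm

theorem relabel_apply {d n : ℕ} (π : Equiv.Perm (Fin n)) (x : Conf d n) (i : Fin n) :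
    relabel d π x i = x (π i) := by
  simp [relabel, LinearIsometryEquiv.piLpCongrLeft_apply, Equiv.piCongrLeft'_apply]

/-- `(U_π ψ)(x_1, …, x_n) = ψ(x_{π 1}, …, x_{π n})`. -/
def permute (d : ℕ) {n : ℕ} (π : Equiv.Perm (Fin n)) : L2 d n →ₗᵢ[ℂ] L2 d n :=
  Lp.compMeasurePreservingₗᵢ ℂ (relabel d π) (relabel d π).measurePreserving

/-- The antisymmetric subspace `(L²(ℝ^d)^{⊗n})^-`. -/
def Sector (d n : ℕ) : Submodule ℂ (L2 d n) where
  carrier := {ψ | ∀ π : Equiv.Perm (Fin n),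
    permute d π ψ = ((Equiv.Perm.sign π : ℤ) : ℂ) • ψ}
  add_mem' {a b} ha hb π := by rw [map_add, ha π, hb π, smul_add]
  zero_mem' π := by simp
  smul_mem' c a ha π := by rw [map_smul, ha π, smul_comm]

instance (d n : ℕ) : CompleteSpace (Sector d n) := by
  have h : IsClosed ((Sector d n : Submodule ℂ (L2 d n)) : Set (L2 d n)) := by
    have : ((Sector d n : Submodule ℂ (L2 d n)) : Set (L2 d n)) =
        ⋂ π : Equiv.Perm (Fin n),
          {ψ | permute d π ψ = ((Equiv.Perm.sign π : ℤ) : ℂ) • ψ} := by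
      ext ψ
      simp [Sector]
    rw [this]
    exact isClosed_iInter fun π =>
      isClosed_eq (permute d π).continuous (continuous_const_smul _)
  exact h.completeSpace_coe

/-- The orthogonal projection `L²(ℝ^d)^{⊗n} → (L²(ℝ^d)^{⊗n})^-`, i.e. antisymmetrization. -/
def antisymm (d n : ℕ) : L2 d n →L[ℂ] Sector d n := (Sector d n).orthogonalProjectionOnto

/-- The fermionic Fock space `⨁_n (L²(ℝ^d)^{⊗n})^-` (Hilbert space direct sum). -/
abbrev Fock (d : ℕ) := lp (fun n : ℕ => Sector d n) 2

/-! ## Creation and annihilation operators -/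

/-- `(x_1, …, x_{n+1}) ↦ (x_1, (x_2, …, x_{n+1}))`, as a linear isometry. -/
def splitIso (d n : ℕ) : Conf d (n + 1) ≃ₗᵢ[ℝ] WithLp 2 (Pos d × Conf d n) where
  toFun x := WithLp.toLp 2 (x 0, WithLp.toLp 2 fun i => x i.succ)
  invFun y := WithLp.toLp 2 (Fin.cons y.fst fun i => y.snd i)
  left_inv x := by
    ext i : 1
    refine Fin.cases ?_ (fun j => ?_) i <;> simp
  right_inv y := rfl
  map_add' x y := rfl
  map_smul' c x := rfl
  norm_map' x := by
    rw [← sq_eq_sq₀ (norm_nonneg _) (norm_nonneg _)]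
    change ‖WithLp.toLp 2 (x 0, (WithLp.toLp 2 fun i => x i.succ : Conf d n))‖ ^ 2 = _
    rw [WithLp.prod_norm_sq_eq_of_L2, PiLp.norm_sq_eq_of_L2 _ x, Fin.sum_univ_succ]
    congr 1
    exact PiLp.norm_sq_eq_of_L2 _ _

/-- `(x_1, …, x_{n+1}) ↦ (x_1, (x_2, …, x_{n+1}))`. -/
def split (d n : ℕ) (x : Conf d (n + 1)) : Pos d × Conf d n :=
  (x 0, WithLp.toLp 2 fun i => x i.succ)

theorem measurePreserving_split (d n : ℕ) : MeasurePreserving (split d n) :=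
  (WithLp.volume_preserving_ofLp (Pos d) (Conf d n)).comp (splitIso d n).measurePreserving

theorem memLp_tensor {d n : ℕ} (f : OneParticle d) (ψ : L2 d n) :
    MemLp (fun x : Conf d (n + 1) => f (split d n x).1 * ψ (split d n x).2) 2 := by
  have h : MemLp (fun p : Pos d × Conf d n => f p.1 * ψ p.2) 2 volume := by
    have hm : AEStronglyMeasurable (fun p : Pos d × Conf d n => f p.1 * ψ p.2) volume :=
      (Lp.aestronglyMeasurable f).comp_fst.mul (Lp.aestronglyMeasurable ψ).comp_snd
    rw [memLp_two_iff_integrable_sq_norm hm]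
    have := ((memLp_two_iff_integrable_sq_norm (Lp.aestronglyMeasurable f)).1
      (Lp.memLp f)).mul_prod ((memLp_two_iff_integrable_sq_norm
        (Lp.aestronglyMeasurable ψ)).1 (Lp.memLp ψ))
    refine this.congr (ae_of_all _ fun p => ?_)
    simp [mul_pow]
  exact h.comp_measurePreserving (measurePreserving_split d n)

theorem L2_norm_sq {α : Type*} [MeasurableSpace α] {μ : Measure α} (f : Lp ℂ 2 μ) :
    ‖f‖ ^ 2 = ∫ x, ‖f x‖ ^ 2 ∂μ := by
  have h := L2.inner_def (𝕜 := ℂ) f f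
  rw [inner_self_eq_norm_sq_to_K] at h
  have h2 : ∀ x, ⟪f x, f x⟫_ℂ = ((‖f x‖ ^ 2 : ℝ) : ℂ) := fun x => by
    rw [inner_self_eq_norm_sq_to_K]; push_cast; rfl
  simp only [h2] at h
  rw [← Complex.ofReal_inj, Complex.ofReal_pow]
  exact h.trans integral_complex_ofReal

theorem norm_tensor {d n : ℕ} (f : OneParticle d) (ψ : L2 d n) :
    ‖(memLp_tensor f ψ).toLp‖ = ‖f‖ * ‖ψ‖ := by
  rw [← sq_eq_sq₀ (norm_nonneg _) (by positivity), mul_pow, L2_norm_sq, L2_norm_sq, L2_norm_sq,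
    ← integral_prod_mul]
  have hm : AEStronglyMeasurable (fun p : Pos d × Conf d n => ‖f p.1‖ ^ 2 * ‖ψ p.2‖ ^ 2)
      volume := ((Lp.aestronglyMeasurable f).norm.pow 2).comp_fst.mul
        ((Lp.aestronglyMeasurable ψ).norm.pow 2).comp_snd
  have h := (measurePreserving_split d n)
  rw [← Measure.volume_eq_prod, ← h.map_eq, integral_map h.measurable.aemeasurable
    (by rw [h.map_eq]; exact hm)]
  refine integral_congr_ae ?_
  filter_upwards [(memLp_tensor f ψ).coeFn_toLp] with x hx
  rw [hx, norm_mul, mul_pow]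

/-- The tensor product `(f ⊗ ψ)(x_1, …, x_{n+1}) = f(x_1) ψ(x_2, …, x_{n+1})`. -/
def tensor {d : ℕ} (n : ℕ) (f : OneParticle d) : L2 d n →L[ℂ] L2 d (n + 1) :=
  LinearMap.mkContinuous
    { toFun := fun ψ => (memLp_tensor f ψ).toLp
      map_add' := fun ψ φ => by
        rw [← MemLp.toLp_add]
        refine MemLp.toLp_congr _ _ ?_
        filter_upwards [(measurePreserving_split d n).quasiMeasurePreserving.ae
          (Measure.quasiMeasurePreserving_snd.ae (Lp.coeFn_add ψ φ))] with x hx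
        simp only [hx, Pi.add_apply]
        exact mul_add _ _ _
      map_smul' := fun c ψ => by
        rw [RingHom.id_apply, ← MemLp.toLp_const_smul]
        refine MemLp.toLp_congr _ _ ?_
        filter_upwards [(measurePreserving_split d n).quasiMeasurePreserving.ae
          (Measure.quasiMeasurePreserving_snd.ae (Lp.coeFn_smul c ψ))] with x hx
        simp only [hx, Pi.smul_apply, smul_eq_mul]
        ring } ‖f‖ (fun ψ => (norm_tensor f ψ).le)

/-- The creation operator `a*(f)` from `n` to `n + 1` particles:
`a*(f) ψ = √(n+1) P_-(f ⊗ ψ)`, with `P_-` the antisymmetrization. -/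
def creation {d : ℕ} (n : ℕ) (f : OneParticle d) : Sector d n →L[ℂ] Sector d (n + 1) :=
  ((√(n + 1 : ℝ) : ℝ) : ℂ) • (antisymm d (n + 1) ∘L tensor n f ∘L (Sector d n).subtypeL)

/-- The annihilation operator `a(f)` from `n + 1` to `n` particles, the adjoint of `a*(f)`:
`(a(f) ψ)(x_1, …, x_n) = √(n+1) ∫ conj (f x) ψ(x, x_1, …, x_n) dx`. -/
def annihilation {d : ℕ} (n : ℕ) (f : OneParticle d) : Sector d (n + 1) →L[ℂ] Sector d n :=
  (creation n f).adjoint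

/-- The operator `a*(f) a*(g) a(g) a(f)` on the `n`-particle space; it vanishes for `n = 0, 1`,
where `a(g) a(f) = 0`. -/
def quartic {d : ℕ} (f g : OneParticle d) : ∀ n : ℕ, Sector d n →L[ℂ] Sector d n
  | 0 => 0
  | 1 => 0
  | n + 2 => creation (n + 1) f ∘L creation n g ∘L annihilation n g ∘L annihilation (n + 1) f

/-! ## The smeared pair interaction -/

/-- The `L¹`-normalized Gaussian of variance `σ²` centred at `x`. -/
def gaussian {d : ℕ} (σ : ℝ) (x y : Pos d) : ℝ :=
  1 / (2 * Real.pi * σ ^ 2) ^ ((d : ℝ) / 2) * Real.exp (-‖y - x‖ ^ 2 / (2 * σ ^ 2))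

theorem memLp_gaussian {d : ℕ} {σ : ℝ} (hσ : 0 < σ) (x : Pos d) :
    MemLp (fun y => (gaussian σ x y : ℂ)) 2 := by
  have hm : Continuous (fun y => (gaussian σ x y : ℂ)) := by
    unfold gaussian
    fun_prop
  rw [memLp_two_iff_integrable_sq_norm hm.aestronglyMeasurable]
  have h0 := GaussianFourier.integrable_cexp_neg_mul_sq_norm_add (V := Pos d)
    (b := ((1 / σ ^ 2 : ℝ) : ℂ)) (by rw [Complex.ofReal_re]; positivity) 0 0
  have h := ((h0.norm.comp_sub_right x).const_mul
    ((1 / (2 * Real.pi * σ ^ 2) ^ ((d : ℝ) / 2)) ^ 2))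
  refine h.congr (ae_of_all _ fun y => ?_)
  simp only [Complex.norm_exp, gaussian, Complex.norm_real, Real.norm_eq_abs, sq_abs, mul_pow]
  congr 1
  rw [← Real.exp_nat_mul]
  congr 1
  rw [zero_mul, add_zero, ← Complex.ofReal_pow, ← Complex.ofReal_neg, ← Complex.ofReal_mul,
    Complex.ofReal_re]
  push_cast
  field_simp


/-- The Gaussian `φ_x^σ` as an element of `L²(ℝ^d)` (for `σ > 0`). -/
def gaussianL2 {d : ℕ} (σ : ℝ) (x : Pos d) : OneParticle d :=
  if hσ : 0 < σ then (memLp_gaussian hσ x).toLp else 0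

/-- `W_Λ(x, y) = χ_{Λ × Λ}(x, y) W(x - y)`. -/
def restrictedPair {d : ℕ} (W : Pos d → ℝ) (Λ : Set (Pos d)) (x y : Pos d) : ℝ :=
  (Λ ×ˢ Λ).indicator (fun p => W (p.1 - p.2)) (x, y)

/-- The bounded operator `T` on the `n`-particle space is the integral
`½ ∫∫ W_Λ(x, y) a*(φ_x^σ) a*(φ_y^σ) a(φ_y^σ) a(φ_x^σ) dx dy`, understood weakly: all matrix
elements of the integrand are absolutely integrable, and their integrals are the matrix elements
of `T`. At most one operator `T` has this property. -/
def IsSmearedInteraction {d : ℕ} (W : Pos d → ℝ) (Λ : Set (Pos d)) (σ : ℝ) (n : ℕ)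
    (T : Sector d n →L[ℂ] Sector d n) : Prop :=
  ∀ φ ψ : Sector d n,
    Integrable (fun p : Pos d × Pos d => (restrictedPair W Λ p.1 p.2 : ℂ) *
      ⟪φ, quartic (gaussianL2 σ p.1) (gaussianL2 σ p.2) n ψ⟫_ℂ) ∧
    ⟪φ, T ψ⟫_ℂ = 1 / 2 * ∫ p : Pos d × Pos d, (restrictedPair W Λ p.1 p.2 : ℂ) *
      ⟪φ, quartic (gaussianL2 σ p.1) (gaussianL2 σ p.2) n ψ⟫_ℂ

theorem IsSmearedInteraction.unique {d : ℕ} {W : Pos d → ℝ} {Λ : Set (Pos d)} {σ : ℝ} {n : ℕ}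
    {S T : Sector d n →L[ℂ] Sector d n} (hS : IsSmearedInteraction W Λ σ n S)
    (hT : IsSmearedInteraction W Λ σ n T) : S = T :=
  ContinuousLinearMap.ext fun ψ => ext_inner_left ℂ fun φ => by
    rw [(hS φ ψ).2, (hT φ ψ).2]

open scoped Classical in
/-- The smeared interaction `W_{Λ;n}^σ` on the `n`-particle space: the bounded operator that is
the weak integral above. -/
def smearedInteraction {d : ℕ} (W : Pos d → ℝ) (Λ : Set (Pos d)) (σ : ℝ) (n : ℕ) :
    Sector d n →L[ℂ] Sector d n :=
  if h : ∃ T, IsSmearedInteraction W Λ σ n T then h.choose else 0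

/-! ## Multiplication operators and the point interaction -/

/-- Multiplication by a real essentially bounded function. -/
def mulOp {d n : ℕ} {g : Conf d n → ℝ} (hg : MemLp g ⊤) : L2 d n →L[ℂ] L2 d n :=
  LinearMap.mkContinuous
    { toFun := fun ψ => (hg.ofReal.toLp : Lp ℂ ⊤ (volume : Measure (Conf d n))) • ψ
      map_add' := fun _ _ => Lp.add_smul _ _ _
      map_smul' := fun _ _ => (Lp.smul_comm _ _ _).symm }
    ‖(hg.ofReal.toLp : Lp ℂ ⊤ (volume : Measure (Conf d n)))‖
    (fun _ => Lp.norm_smul_le _ _)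

theorem mulOp_coeFn {d n : ℕ} {g : Conf d n → ℝ} (hg : MemLp g ⊤) (ψ : L2 d n) :
    mulOp hg ψ =ᵐ[volume] fun x => (g x : ℂ) * ψ x := by
  filter_upwards [Lp.coeFn_lpSMul (r := 2)
    (hg.ofReal.toLp : Lp ℂ ⊤ (volume : Measure (Conf d n))) ψ,
    (hg.ofReal (K := ℂ)).coeFn_toLp] with x hx hx'
  refine hx.trans ?_
  rw [Pi.smul_apply', hx']
  rfl

/-- The external potential `∑_k V(x_k)`. -/
def onePotential {d : ℕ} (V : Pos d → ℝ) (n : ℕ) (x : Conf d n) : ℝ := ∑ k, V (x k)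

/-- The pair potential `∑_{k < l} W_Λ(x_k, x_l)`. -/
def pairPotential {d : ℕ} (W : Pos d → ℝ) (Λ : Set (Pos d)) (n : ℕ) (x : Conf d n) : ℝ :=
  ∑ k, ∑ l ∈ Finset.Ioi k, restrictedPair W Λ (x k) (x l)

theorem quasiMeasurePreserving_of_surjective {E F : Type*}
    [NormedAddCommGroup E] [InnerProductSpace ℝ E] [FiniteDimensional ℝ E] [MeasurableSpace E]
    [BorelSpace E] [NormedAddCommGroup F] [InnerProductSpace ℝ F] [FiniteDimensional ℝ F]
    [MeasurableSpace F] [BorelSpace F] (L : E →ₗ[ℝ] F) (hL : Function.Surjective L) :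
    Measure.QuasiMeasurePreserving L (volume : Measure E) volume := by
  refine ⟨L.continuous_of_finiteDimensional.measurable, ?_⟩
  obtain ⟨c, -, hc⟩ := L.exists_map_addHaar_eq_smul_addHaar
    (volume : Measure E) (volume : Measure F) hL
  rw [hc]
  exact Measure.smul_absolutelyContinuous

theorem memLp_top_comp {d n : ℕ} {V : Pos d → ℝ} (hV : MemLp V ⊤)
    {L : Conf d n → Pos d}
    (hL : Measure.QuasiMeasurePreserving L (volume : Measure (Conf d n)) volume) :
    MemLp (fun x => V (L x)) ⊤ (volume : Measure (Conf d n)) := by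
  have h : MemLp V ⊤ (Measure.map L volume) :=
    ⟨hV.1.mono_ac hL.absolutelyContinuous, by
      rw [eLpNorm_exponent_top]
      exact (eLpNormEssSup_mono_measure V hL.absolutelyContinuous).trans_lt
        (by simpa [eLpNorm_exponent_top] using hV.2)⟩
  exact (memLp_map_measure_iff h.1 hL.aemeasurable).1 h

theorem quasiMeasurePreserving_coord {d n : ℕ} (k : Fin n) :
    Measure.QuasiMeasurePreserving (fun x : Conf d n => x k) volume volume :=
  quasiMeasurePreserving_of_surjective
    { toFun := fun x : Conf d n => x k, map_add' := fun _ _ => rfl, map_smul' := fun _ _ => rfl }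
    (fun y => ⟨WithLp.toLp 2 fun _ => y, rfl⟩)

theorem quasiMeasurePreserving_coord_sub {d n : ℕ} {k l : Fin n} (hkl : k ≠ l) :
    Measure.QuasiMeasurePreserving (fun x : Conf d n => x k - x l) volume volume :=
  quasiMeasurePreserving_of_surjective
    { toFun := fun x : Conf d n => x k - x l
      map_add' := fun x y => by simp only [PiLp.add_apply]; abel
      map_smul' := fun c x => by simp [smul_sub] }
    (fun y => ⟨WithLp.toLp 2 (Pi.single k y), by
      change (Pi.single k y : Fin n → Pos d) k - (Pi.single k y : Fin n → Pos d) l = y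
      simp [hkl.symm]⟩)

theorem memLp_onePotential {d : ℕ} {V : Pos d → ℝ} (hV : MemLp V ⊤) (n : ℕ) :
    MemLp (onePotential V n) ⊤ :=
  memLp_finsetSum _ fun k _ => memLp_top_comp hV (quasiMeasurePreserving_coord k)

theorem memLp_pairPotential {d : ℕ} {W : Pos d → ℝ} (hW : MemLp W ⊤) {Λ : Set (Pos d)}
    (hΛ : NullMeasurableSet Λ) (n : ℕ) : MemLp (pairPotential W Λ n) ⊤ := by
  refine memLp_finsetSum _ fun k _ => memLp_finsetSum _ fun l hl => ?_
  have hkl : k ≠ l := (Finset.mem_Ioi.1 hl).ne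
  have hs : NullMeasurableSet
      ((fun x : Conf d n => x k) ⁻¹' Λ ∩ (fun x : Conf d n => x l) ⁻¹' Λ) :=
    (hΛ.preimage (quasiMeasurePreserving_coord k)).inter
      (hΛ.preimage (quasiMeasurePreserving_coord l))
  have h := memLp_top_comp hW (quasiMeasurePreserving_coord_sub (d := d) hkl)
  have h2 : MemLp (((fun x : Conf d n => x k) ⁻¹' Λ ∩ (fun x : Conf d n => x l) ⁻¹' Λ).indicator
      fun x => W (x k - x l)) ⊤ :=
    ⟨h.1.indicator₀ hs, (eLpNorm_indicator_le _).trans_lt h.2⟩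
  exact h2

/-- The point interaction `W_{Λ;n}^0`: multiplication by `∑_{k < l} W_Λ(x_k, x_l)`, followed by
antisymmetrization. If `W` is even, the product is already antisymmetric and the projection acts as
the identity; in general it replaces `W` by its even part `(W(x) + W(-x)) / 2`. -/
def pointInteraction {d : ℕ} {W : Pos d → ℝ} (hW : MemLp W ⊤) {Λ : Set (Pos d)}
    (hΛ : NullMeasurableSet Λ) (n : ℕ) : Sector d n →L[ℂ] Sector d n :=
  antisymm d n ∘L mulOp (memLp_pairPotential hW hΛ n) ∘L (Sector d n).subtypeL

/-! ## The Hamiltonians -/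

section Laplacian

variable (E : Type*) [NormedAddCommGroup E] [InnerProductSpace ℝ E] [FiniteDimensional ℝ E]
  [MeasurableSpace E] [BorelSpace E]

theorem exists_laplacian {ψ : Lp ℂ 2 (volume : Measure E)}
    (hψ : TemperedDistribution.MemSobolev 2 2 (ψ : 𝓢'(E, ℂ))) :
    ∃ χ : Lp ℂ 2 (volume : Measure E), (χ : 𝓢'(E, ℂ)) = Δ (ψ : 𝓢'(E, ℂ)) := by
  have h := hψ.laplacian
  rw [sub_self, TemperedDistribution.memSobolev_zero_iff] at h
  obtain ⟨χ, hχ⟩ := h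
  exact ⟨χ, hχ.symm⟩

theorem toTemperedDistribution_injective {ψ χ : Lp ℂ 2 (volume : Measure E)}
    (h : (ψ : 𝓢'(E, ℂ)) = (χ : 𝓢'(E, ℂ))) : ψ = χ :=
  LinearMap.ker_eq_bot.1
    (Lp.ker_toTemperedDistributionCLM_eq_bot (F := ℂ) (p := 2) (μ := (volume : Measure E))) h

theorem toTemperedDistribution_add (ψ χ : Lp ℂ 2 (volume : Measure E)) :
    ((ψ + χ : Lp ℂ 2 (volume : Measure E)) : 𝓢'(E, ℂ)) = (ψ : 𝓢'(E, ℂ)) + (χ : 𝓢'(E, ℂ)) :=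
  map_add (Lp.toTemperedDistributionCLM ℂ (volume : Measure E) 2) ψ χ

theorem toTemperedDistribution_smul (c : ℂ) (ψ : Lp ℂ 2 (volume : Measure E)) :
    ((c • ψ : Lp ℂ 2 (volume : Measure E)) : 𝓢'(E, ℂ)) = c • (ψ : 𝓢'(E, ℂ)) :=
  map_smul (Lp.toTemperedDistributionCLM ℂ (volume : Measure E) 2) c ψ

/-- The Sobolev space `H²(E)` as a subspace of `L²(E)`. -/
def sobolevTwo : Submodule ℂ (Lp ℂ 2 (volume : Measure E)) where
  carrier := {ψ | TemperedDistribution.MemSobolev 2 2 (ψ : 𝓢'(E, ℂ))}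
  add_mem' {a b} ha hb := by
    rw [Set.mem_ofPred_eq, toTemperedDistribution_add]
    exact TemperedDistribution.MemSobolev.add ha hb
  zero_mem' := by
    have h := TemperedDistribution.memSobolev_fun_zero E ℂ 2 2
    rwa [← map_zero (Lp.toTemperedDistributionCLM ℂ (volume : Measure E) 2)] at h
  smul_mem' c a ha := by
    rw [Set.mem_ofPred_eq, toTemperedDistribution_smul]
    exact TemperedDistribution.MemSobolev.smul c ha

/-- The Laplace operator on `L²(E)`, for a Euclidean space `E`, with domain the Sobolev space
`H²(E)`: the value at `ψ` is the `L²` function that represents the distributional Laplacian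
of `ψ`. -/
def laplacian : Lp ℂ 2 (volume : Measure E) →ₗ.[ℂ] Lp ℂ 2 (volume : Measure E) where
  domain := sobolevTwo E
  toFun :=
    { toFun := fun ψ => (exists_laplacian E ψ.2).choose
      map_add' := fun a b => by
        apply toTemperedDistribution_injective
        rw [(exists_laplacian E (a + b).2).choose_spec, toTemperedDistribution_add,
          (exists_laplacian E a.2).choose_spec, (exists_laplacian E b.2).choose_spec,
          Submodule.coe_add, toTemperedDistribution_add]
        simp only [← TemperedDistribution.laplacianCLM_apply, map_add]
      map_smul' := fun c a => by
        apply toTemperedDistribution_injective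
        rw [(exists_laplacian E (c • a).2).choose_spec, RingHom.id_apply,
          toTemperedDistribution_smul, (exists_laplacian E a.2).choose_spec,
          Submodule.coe_smul, toTemperedDistribution_smul]
        simp only [← TemperedDistribution.laplacianCLM_apply, map_smul] }

theorem laplacian_spec (ψ : (laplacian E).domain) :
    ((laplacian E ψ : Lp ℂ 2 (volume : Measure E)) : 𝓢'(E, ℂ)) =
      Δ ((ψ : Lp ℂ 2 (volume : Measure E)) : 𝓢'(E, ℂ)) :=
  (exists_laplacian E ψ.2).choose_spec

end Laplacian

/-- The orthogonal direct sum of partially defined operators `A n`: its domain is the set of all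
`ψ` in the Hilbert space direct sum such that every `ψ n` is in the domain of `A n` and
`∑_n ‖A n (ψ n)‖² < ∞`. -/
def directSum {G : ℕ → Type*} [∀ n, NormedAddCommGroup (G n)] [∀ n, InnerProductSpace ℂ (G n)]
    (A : ∀ n, G n →ₗ.[ℂ] G n) : lp G 2 →ₗ.[ℂ] lp G 2 where
  domain :=
    { carrier := {ψ | ∃ h : ∀ n, ψ n ∈ (A n).domain, Memℓp (fun n => A n ⟨ψ n, h n⟩) 2}
      add_mem' := fun {a b} ⟨ha, ha'⟩ ⟨hb, hb'⟩ => by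
        refine ⟨fun n => add_mem (ha n) (hb n), ?_⟩
        have h := ha'.add hb'
        have e : (fun n => A n ⟨a n, ha n⟩) + (fun n => A n ⟨b n, hb n⟩) =
            fun n => A n ⟨(a + b) n, add_mem (ha n) (hb n)⟩ :=
          funext fun n => ((A n).map_add ⟨a n, ha n⟩ ⟨b n, hb n⟩).symm
        rwa [e] at h
      zero_mem' := by
        refine ⟨fun n => zero_mem _, ?_⟩
        have h : Memℓp (0 : ∀ n, G n) 2 := zero_memℓp
        have e : (0 : ∀ n, G n) = fun n => A n ⟨(0 : lp G 2) n, zero_mem _⟩ :=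
          funext fun n => ((A n).map_zero).symm
        rwa [e] at h
      smul_mem' := fun c a ⟨ha, ha'⟩ => by
        refine ⟨fun n => Submodule.smul_mem _ c (ha n), ?_⟩
        have h := ha'.const_smul c
        have e : c • (fun n => A n ⟨a n, ha n⟩) =
            fun n => A n ⟨(c • a) n, Submodule.smul_mem _ c (ha n)⟩ :=
          funext fun n => ((A n).map_smul c ⟨a n, ha n⟩).symm
        rwa [e] at h }
  toFun :=
    { toFun := fun ψ => ⟨fun n => A n ⟨ψ.1 n, ψ.2.choose n⟩, ψ.2.choose_spec⟩
      map_add' := fun a b => by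
        ext1
        funext n
        exact (A n).map_add ⟨a.1 n, a.2.choose n⟩ ⟨b.1 n, b.2.choose n⟩
      map_smul' := fun c a => by
        ext1
        funext n
        exact (A n).map_smul c ⟨a.1 n, a.2.choose n⟩ }

/-- The `n`-particle Hamiltonian `∑_k (-Δ_k + V(x_k)) + B` on antisymmetric functions, where `B` is
a bounded operator. Its domain consists of the antisymmetric functions in `H²((ℝ^d)^n)`. The
projection `antisymm` only serves to land in the antisymmetric subspace: the first
summand commutes with permutations of the particles. -/
def sectorHamiltonian {d n : ℕ} {V : Pos d → ℝ} (hV : MemLp V ⊤)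
    (B : Sector d n →L[ℂ] Sector d n) : Sector d n →ₗ.[ℂ] Sector d n where
  domain := (laplacian (Conf d n)).domain.comap (Sector d n).subtype
  toFun :=
    (antisymm d n).toLinearMap ∘ₗ
        (-((laplacian (Conf d n)).toFun ∘ₗ
            (Sector d n).subtype.restrict (q := (laplacian (Conf d n)).domain) fun _ h => h)
          + (mulOp (memLp_onePotential hV n)).toLinearMap ∘ₗ (Sector d n).subtype ∘ₗ
              Submodule.subtype _)
      + B.toLinearMap ∘ₗ Submodule.subtype _

theorem sectorHamiltonian_apply {d n : ℕ} {V : Pos d → ℝ} (hV : MemLp V ⊤)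
    (B : Sector d n →L[ℂ] Sector d n) (ψ : (sectorHamiltonian hV B).domain) :
    sectorHamiltonian hV B ψ =
      antisymm d n (-(laplacian (Conf d n) ⟨(ψ : Sector d n), ψ.2⟩)
        + mulOp (memLp_onePotential hV n) (ψ : Sector d n)) + B ψ := rfl

/-- The Fock space Hamiltonian `⨁_n (H_{1;n} + B_n)` for bounded interactions `B_n` on the
`n`-particle spaces. -/
def hamiltonian {d : ℕ} {V : Pos d → ℝ} (hV : MemLp V ⊤)
    (B : ∀ n, Sector d n →L[ℂ] Sector d n) : Fock d →ₗ.[ℂ] Fock d :=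
  directSum fun n => sectorHamiltonian hV (B n)

/-! ## Strong resolvent convergence -/

/-- The bounded operator `R` is the resolvent `(A - z)⁻¹` of the partially defined operator `A`. -/
def IsResolvent {H : Type*} [NormedAddCommGroup H] [InnerProductSpace ℂ H]
    (A : H →ₗ.[ℂ] H) (z : ℂ) (R : H →L[ℂ] H) : Prop :=
  (∀ x : H, ∃ h : R x ∈ A.domain, A ⟨R x, h⟩ - z • R x = x) ∧
    ∀ y : A.domain, R (A y - z • (y : H)) = y

/-- Convergence in the strong resolvent sense of self-adjoint operators `A i`, along `l`, to a
self-adjoint operator `B`: for every non-real `z`, `(A i - z)⁻¹ → (B - z)⁻¹` strongly. -/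
def StrongResolventConvergence {ι H : Type*} [NormedAddCommGroup H] [InnerProductSpace ℂ H]
    [CompleteSpace H] (A : ι → H →ₗ.[ℂ] H) (l : Filter ι) (B : H →ₗ.[ℂ] H) : Prop :=
  (∀ᶠ i in l, IsSelfAdjoint (A i)) ∧ IsSelfAdjoint B ∧
    ∀ z : ℂ, z.im ≠ 0 → ∃ (R : ι → H →L[ℂ] H) (S : H →L[ℂ] H),
      (∀ᶠ i in l, IsResolvent (A i) z (R i)) ∧ IsResolvent B z S ∧
        ∀ x : H, Tendsto (fun i => R i x) l (𝓝 (S x))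

/-- The Hamiltonian `H_Λ^σ` with smeared pair interaction. -/
def smearedHamiltonian {d : ℕ} {V : Pos d → ℝ} (hV : MemLp V ⊤) (W : Pos d → ℝ)
    (Λ : Set (Pos d)) (σ : ℝ) : Fock d →ₗ.[ℂ] Fock d :=
  hamiltonian hV (smearedInteraction W Λ σ)

/-- The Hamiltonian `H_Λ^0` with point pair interaction. -/
def pointHamiltonian {d : ℕ} {V W : Pos d → ℝ} (hV : MemLp V ⊤) (hW : MemLp W ⊤)
    {Λ : Set (Pos d)} (hΛ : NullMeasurableSet Λ) : Fock d →ₗ.[ℂ] Fock d :=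
  hamiltonian hV (pointInteraction hW hΛ)

end FermiGas

end

/-! Why it holds. On the sector with `n + 2` particles, `a(φ_y^σ) a(φ_x^σ) ψ` is `√((n+2)(n+1))`
times the contraction of the first two variables of `ψ` with `φ_x^σ ⊗ φ_y^σ`. That contraction is
the Gaussian average of `ψ` over translates of the first two particles, evaluated at `(x, y)`. With
`G_σ` for this averaging operator (`smearPair`) and `M` for multiplication by `W_Λ(x₁, x₂)`
(`pairOp`), Fubini turns the weak integral into the matrix elements of `(n+2)(n+1)/2 · G_σ M G_σ`,
compressed to the antisymmetric functions (`coeFn_contract_gaussian_smearPair`,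
`isSmearedInteraction_compress`). This operator is bounded and symmetric for any `Λ`, since only the
essential bound of `W` enters.

Averaging with a fixed even weight over translations by `σ v` is symmetric, bounded uniformly in
`σ`, and tends strongly to the identity (`tendsto_smear`). Hence the smeared interaction tends
strongly to the compression of `(n+2)(n+1)/2 · M`, which is the point interaction because by
antisymmetry all pairs have the same matrix elements (`inner_mulOp_pairPotential`).

Self-adjointness: `-Δ` is controlled by the Fourier multiplier `(1 + |ξ|²)⁻¹`, which commutes with
permutations and so solves the resolvent equation inside each sector; potential and interaction are
bounded symmetric perturbations (`sectorHamiltonian_isSelfAdjoint`). On one sector the resolvent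
identity gives strong convergence. The operator bounds grow with `n`, but all resolvents are bounded
by `|Im z|⁻¹`, so dominated convergence over `n` gives the result on Fock space
(`directSum_strongResolventConvergence`). -/

noncomputable section

namespace FermiGas

open scoped ENNReal SchwartzMap Laplacian InnerProductSpace

/-! ## Instances for the antisymmetric subspaces

These are found by instance search as well, but slowly. -/

/-- The norm of `L2 d n`. -/
abbrev l2NormedAddCommGroup (d n : ℕ) : NormedAddCommGroup (L2 d n) := inferInstance

/-- The inner product of `L2 d n`. -/
abbrev l2InnerProductSpace (d n : ℕ) : InnerProductSpace ℂ (L2 d n) := inferInstance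

/-- The norm of `Sector d n`. -/
abbrev sectorNormedAddCommGroup (d n : ℕ) : NormedAddCommGroup (Sector d n) := inferInstance

/-- The seminorm of `Sector d n`. -/
abbrev sectorSeminormedAddCommGroup (d n : ℕ) : SeminormedAddCommGroup (Sector d n) :=
  inferInstance

/-- The inner product space structure of `Sector d n`. -/
abbrev sectorInnerProductSpace (d n : ℕ) : InnerProductSpace ℂ (Sector d n) := inferInstance

/-- The inner product of `Sector d n`. -/
abbrev sectorInner (d n : ℕ) : Inner ℂ (Sector d n) := inferInstance

/-- The normed space structure of `Sector d n`. -/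
abbrev sectorNormedSpace (d n : ℕ) : NormedSpace ℂ (Sector d n) := inferInstance

/-- The module structure of `Sector d n`. -/
abbrev sectorModule (d n : ℕ) : Module ℂ (Sector d n) := inferInstance

/-- The scalar multiplication of `Sector d n`. -/
abbrev sectorSMul (d n : ℕ) : SMul ℂ (Sector d n) := inferInstance

attribute [local instance] l2NormedAddCommGroup l2InnerProductSpace sectorNormedAddCommGroup
  sectorSeminormedAddCommGroup sectorInnerProductSpace sectorInner sectorNormedSpace sectorModule
  sectorSMul

/-! ## Self-adjoint operators and their resolvents -/

section Abstract

variable {H : Type*} [NormedAddCommGroup H] [InnerProductSpace ℂ H]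

/-- A symmetric operator `A` such that `A - z` and `A - z̄` are surjective is self-adjoint. -/
theorem isSelfAdjoint_of_surjective [CompleteSpace H] {A : H →ₗ.[ℂ] H} (z : ℂ)
    (hA : ∀ x y : A.domain, ⟪A x, (y : H)⟫_ℂ = ⟪(x : H), A y⟫_ℂ)
    (h₁ : ∀ y : H, ∃ x : A.domain, A x - z • (x : H) = y)
    (h₂ : ∀ y : H, ∃ x : A.domain, A x - (starRingEnd ℂ z) • (x : H) = y) :
    IsSelfAdjoint A := by
  have key : ∀ (w : ℂ) (x y : A.domain),
      ⟪A x - (starRingEnd ℂ w) • (x : H), (y : H)⟫_ℂ = ⟪(x : H), A y - w • (y : H)⟫_ℂ := by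
    intro w x y
    rw [inner_sub_left, inner_sub_right, inner_smul_left, inner_smul_right, hA, Complex.conj_conj]
  have hd : Dense (A.domain : Set H) := by
    rw [Submodule.dense_iff_topologicalClosure_eq_top, Submodule.topologicalClosure_eq_top_iff,
      Submodule.eq_bot_iff]
    -- A vector orthogonal to the domain is `(A - z̄) w`; pairing it with `u`, where `(A - z) u =
    -- w`, gives `‖w‖² = 0`.
    intro v hv
    rw [Submodule.mem_orthogonal'] at hv
    obtain ⟨w, rfl⟩ := h₂ v
    obtain ⟨u, hu⟩ := h₁ w
    have h := hv u u.2
    rw [key, hu, inner_self_eq_zero] at h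
    have hw : w = 0 := Subtype.ext h
    simp [hw]
  rw [LinearPMap.isSelfAdjoint_def]
  have hle : A ≤ A.adjoint := LinearPMap.IsFormalAdjoint.le_adjoint hd hA
  refine (LinearPMap.eq_of_le_of_domain_eq hle (le_antisymm hle.1 fun y hy => ?_)).symm
  -- With `(A - z̄) x = (A* - z̄) y`, the difference `y - x` is orthogonal to the range of `A - z`,
  -- which is everything; so `y = x` lies in the domain.
  obtain ⟨x, hx⟩ := h₂ (A.adjoint ⟨y, hy⟩ - (starRingEnd ℂ z) • y)
  obtain ⟨u, hu⟩ := h₁ (y - x)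
  have h1 : ⟪A.adjoint ⟨y, hy⟩, (u : H)⟫_ℂ = ⟪y, A u⟫_ℂ :=
    LinearPMap.adjoint_isFormalAdjoint hd ⟨y, hy⟩ u
  have h2 : ⟪y - (x : H), A u - z • (u : H)⟫_ℂ = 0 := by
    rw [inner_sub_left, ← key, hx, inner_sub_right, inner_sub_left, h1, inner_smul_left,
      inner_smul_right, Complex.conj_conj, sub_self]
  rw [hu, inner_self_eq_zero, sub_eq_zero] at h2
  rw [h2]
  exact x.2

theorem _root_.IsSelfAdjoint.inner_apply_left [CompleteSpace H] {A : H →ₗ.[ℂ] H}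
    (hA : IsSelfAdjoint A) (x y : A.domain) : ⟪A x, (y : H)⟫_ℂ = ⟪(x : H), A y⟫_ℂ := by
  have h := LinearPMap.adjoint_isFormalAdjoint hA.dense_domain
  rw [LinearPMap.isSelfAdjoint_def.1 hA] at h
  exact h x y

/-- `⟪x, A x⟫` is real, so the imaginary part of `⟪x, (A - z) x⟫` is `-Im z ‖x‖²`; then
Cauchy-Schwarz. This is the source of every resolvent bound below, uniform in `σ` and `n`. -/
theorem abs_im_mul_norm_le {A : H →ₗ.[ℂ] H}
    (hA : ∀ x y : A.domain, ⟪A x, (y : H)⟫_ℂ = ⟪(x : H), A y⟫_ℂ) (z : ℂ) (x : A.domain) :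
    |z.im| * ‖(x : H)‖ ≤ ‖A x - z • (x : H)‖ := by
  have h1 : (⟪(x : H), A x⟫_ℂ).im = 0 := by
    rw [← Complex.conj_eq_iff_im, inner_conj_symm, hA]
  have h2 : (⟪(x : H), A x - z • (x : H)⟫_ℂ).im = -(z.im * ‖(x : H)‖ ^ 2) := by
    rw [inner_sub_right, inner_smul_right, inner_self_eq_norm_sq_to_K, Complex.sub_im, h1]
    simp [← Complex.ofReal_pow]
  have h3 : |z.im| * ‖(x : H)‖ ^ 2 ≤ ‖(x : H)‖ * ‖A x - z • (x : H)‖ := by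
    calc |z.im| * ‖(x : H)‖ ^ 2 = |(⟪(x : H), A x - z • (x : H)⟫_ℂ).im| := by
          rw [h2, abs_neg, abs_mul, abs_of_nonneg (sq_nonneg ‖(x : H)‖)]
      _ ≤ ‖⟪(x : H), A x - z • (x : H)⟫_ℂ‖ := Complex.abs_im_le_norm _
      _ ≤ _ := norm_inner_le_norm _ _
  rcases (norm_nonneg (x : H)).eq_or_lt with h | h
  · rw [← h, mul_zero]
    exact norm_nonneg _
  · refine le_of_mul_le_mul_left ?_ h
    linarith [h3, sq (‖(x : H)‖)]

theorem IsResolvent.norm_apply_le {A : H →ₗ.[ℂ] H} {z : ℂ} {R : H →L[ℂ] H}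
    (hR : IsResolvent A z R)
    (hA : ∀ x y : A.domain, ⟪A x, (y : H)⟫_ℂ = ⟪(x : H), A y⟫_ℂ) (hz : z.im ≠ 0) (x : H) :
    ‖R x‖ ≤ |z.im|⁻¹ * ‖x‖ := by
  obtain ⟨h, hx⟩ := hR.1 x
  have := abs_im_mul_norm_le hA z ⟨R x, h⟩
  rw [hx] at this
  rwa [inv_mul_eq_div, le_div_iff₀ (abs_pos.2 hz), mul_comm]

/-- A symmetric operator with `A - z` surjective, `z` not real, has a resolvent at `z`. -/
theorem exists_isResolvent_of_surjective {A : H →ₗ.[ℂ] H}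
    (hA : ∀ x y : A.domain, ⟪A x, (y : H)⟫_ℂ = ⟪(x : H), A y⟫_ℂ) {z : ℂ} (hz : z.im ≠ 0)
    (h : ∀ y : H, ∃ x : A.domain, A x - z • (x : H) = y) : ∃ R, IsResolvent A z R := by
  let f : A.domain →ₗ[ℂ] H := A.toFun - z • A.domain.subtype
  have hf : ∀ x, f x = A x - z • (x : H) := fun x => rfl
  have hinj : Function.Injective f := by
    rw [injective_iff_map_eq_zero]
    intro x hx
    have := abs_im_mul_norm_le hA z x
    rw [← hf, hx, norm_zero] at this
    have h0 : ‖(x : H)‖ ≤ 0 := nonpos_of_mul_nonpos_right this (abs_pos.2 hz)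
    exact Subtype.ext (norm_le_zero_iff.1 h0)
  let e : A.domain ≃ₗ[ℂ] H := LinearEquiv.ofBijective f ⟨hinj, h⟩
  have he : ∀ y, A (e.symm y) - z • (e.symm y : H) = y := fun y => e.apply_symm_apply y
  refine ⟨(A.domain.subtype ∘ₗ e.symm.toLinearMap).mkContinuous |z.im|⁻¹ fun y => ?_,
    fun y => ⟨(e.symm y).2, he y⟩, fun y => congrArg Subtype.val (e.symm_apply_apply y)⟩
  have := abs_im_mul_norm_le hA z (e.symm y)
  rw [he] at this
  rw [inv_mul_eq_div, le_div_iff₀ (abs_pos.2 hz), mul_comm]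
  exact this

variable [CompleteSpace H]

/-- The range is closed, because `A - z` is bounded below on the closed graph of `A`. It is dense,
because a vector orthogonal to it would be an eigenvector of `A* = A` for the non-real number `z̄`.
-/
theorem _root_.IsSelfAdjoint.exists_sub_smul_eq {A : H →ₗ.[ℂ] H} (hA : IsSelfAdjoint A) {z : ℂ}
    (hz : z.im ≠ 0) (y : H) : ∃ x : A.domain, A x - z • (x : H) = y := by
  have hz0 : 0 < |z.im| := abs_pos.2 hz
  have : CompleteSpace A.graph := by
    have h : IsClosed (A.graph : Set (H × H)) := hA.isClosed
    exact h.completeSpace_coe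
  let f : A.graph →L[ℂ] H :=
    (ContinuousLinearMap.snd ℂ H H - z • ContinuousLinearMap.fst ℂ H H) ∘L A.graph.subtypeL
  have hf : ∀ p : A.graph, f p = p.1.2 - z • p.1.1 := fun p => rfl
  have hfd : ∀ p : A.graph, ∃ x : A.domain, p.1.1 = x ∧ p.1.2 = A x ∧ f p = A x - z • (x : H) := by
    intro p
    obtain ⟨x, hx1, hx2⟩ := (LinearPMap.mem_graph_iff A).1 p.2
    exact ⟨x, hx1.symm, hx2.symm, by rw [hf, hx1, hx2]⟩
  -- Large enough for both entries of the graph norm: `‖x‖ ≤ |Im z|⁻¹ ‖f p‖` and `‖A x‖ ≤ ‖f p‖ +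
  -- ‖z‖ ‖x‖`.
  let C : ℝ := 1 + (1 + ‖z‖) * |z.im|⁻¹
  have hC : 0 ≤ C := by positivity
  have hbound : ∀ p : A.graph, ‖p‖ ≤ (⟨C, hC⟩ : NNReal) * ‖f p‖ := by
    intro p
    obtain ⟨x, h1, h2, h3⟩ := hfd p
    have hx : ‖(x : H)‖ ≤ |z.im|⁻¹ * ‖f p‖ := by
      rw [h3, inv_mul_eq_div, le_div_iff₀ hz0, mul_comm]
      exact abs_im_mul_norm_le hA.inner_apply_left z x
    have hAx : ‖A x‖ ≤ ‖f p‖ + ‖z‖ * ‖(x : H)‖ := by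
      rw [← norm_smul]
      calc ‖A x‖ = ‖f p + z • (x : H)‖ := by rw [h3, sub_add_cancel]
        _ ≤ _ := norm_add_le _ _
    change ‖p.1‖ ≤ C * ‖f p‖
    rw [Prod.norm_def, h1, h2]
    have h5 : ‖z‖ * ‖(x : H)‖ ≤ ‖z‖ * (|z.im|⁻¹ * ‖f p‖) := by gcongr
    have h6 : 0 ≤ |z.im|⁻¹ * ‖f p‖ := by positivity
    have h7 : 0 ≤ ‖z‖ * (|z.im|⁻¹ * ‖f p‖) := by positivity
    have h8 : C * ‖f p‖ = ‖f p‖ + |z.im|⁻¹ * ‖f p‖ + ‖z‖ * (|z.im|⁻¹ * ‖f p‖) := by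
      simp only [C]; ring
    rw [h8]
    have := norm_nonneg (f p)
    exact max_le (by linarith) (by linarith)
  have hcl : IsClosed (Set.range f) :=
    (f.antilipschitz_of_bound hbound).isClosed_range f.uniformContinuous
  have hcl' : IsClosed ((LinearMap.range f.toLinearMap : Submodule ℂ H) : Set H) := hcl
  have htop : LinearMap.range f.toLinearMap = ⊤ := by
    rw [← hcl'.submodule_topologicalClosure_eq, Submodule.topologicalClosure_eq_top_iff,
      Submodule.eq_bot_iff]
    intro v hv
    rw [Submodule.mem_orthogonal'] at hv
    have hv' : ∀ x : A.domain, ⟪(starRingEnd ℂ z) • v, (x : H)⟫_ℂ = ⟪v, A x⟫_ℂ := by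
      intro x
      have := hv _ ⟨⟨(x, A x), LinearPMap.mem_graph A x⟩, rfl⟩
      change ⟪v, A x - z • (x : H)⟫_ℂ = 0 at this
      rw [inner_sub_right, inner_smul_right, sub_eq_zero] at this
      rw [inner_smul_left, Complex.conj_conj, this]
    have hmem : v ∈ A.adjoint.domain := LinearPMap.mem_adjoint_domain_of_exists v ⟨_, hv'⟩
    have hval : A.adjoint ⟨v, hmem⟩ = (starRingEnd ℂ z) • v :=
      LinearPMap.adjoint_apply_eq hA.dense_domain ⟨v, hmem⟩ hv'
    have hadj : A.adjoint = A := LinearPMap.isSelfAdjoint_def.1 hA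
    have hmem' : v ∈ A.domain := hadj ▸ hmem
    have hval' : A ⟨v, hmem'⟩ = (starRingEnd ℂ z) • v := by
      rw [← hval]
      exact hadj.ge.2 rfl
    have := abs_im_mul_norm_le hA.inner_apply_left (starRingEnd ℂ z) ⟨v, hmem'⟩
    rw [hval', sub_self, norm_zero, Complex.conj_im, abs_neg] at this
    exact norm_le_zero_iff.1 (nonpos_of_mul_nonpos_right this hz0)
  obtain ⟨p, hp⟩ := LinearMap.range_eq_top.1 htop y
  obtain ⟨x, -, -, h3⟩ := hfd p
  exact ⟨x, h3.symm.trans hp⟩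

theorem _root_.IsSelfAdjoint.exists_isResolvent {A : H →ₗ.[ℂ] H} (hA : IsSelfAdjoint A) {z : ℂ}
    (hz : z.im ≠ 0) : ∃ R, IsResolvent A z R :=
  exists_isResolvent_of_surjective hA.inner_apply_left hz (hA.exists_sub_smul_eq hz)

/-- A bounded symmetric perturbation of a self-adjoint operator is self-adjoint. -/
theorem _root_.IsSelfAdjoint.of_bounded_perturbation {A A' : H →ₗ.[ℂ] H} (hA : IsSelfAdjoint A)
    {S : H →L[ℂ] H} (hS : ∀ x y, ⟪S x, y⟫_ℂ = ⟪x, S y⟫_ℂ) (hd : A.domain ≤ A'.domain)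
    (hd' : A'.domain ≤ A.domain)
    (h : ∀ (x : A.domain), A' ⟨x, hd x.2⟩ = A x + S x) : IsSelfAdjoint A' := by
  have hsurj : ∀ z : ℂ, |z.im| = ‖S‖ + 1 → ∀ y, ∃ x : A'.domain, A' x - z • (x : H) = y := by
    intro z hz y
    have hz' : z.im ≠ 0 := abs_pos.1 (hz ▸ by positivity)
    obtain ⟨R, hR⟩ := hA.exists_isResolvent hz'
    -- `A + S - z = (1 + S R)(A - z)`; the choice `|Im z| = ‖S‖ + 1` makes `1 + S R` invertible by a
    -- Neumann series.
    have hn : ‖-(S ∘L R)‖ < 1 := by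
      rw [norm_neg]
      have h1 : ‖R‖ ≤ |z.im|⁻¹ := ContinuousLinearMap.opNorm_le_bound _ (by positivity)
        (hR.norm_apply_le hA.inner_apply_left hz')
      calc ‖S ∘L R‖ ≤ ‖S‖ * |z.im|⁻¹ := (ContinuousLinearMap.opNorm_comp_le _ _).trans (by gcongr)
        _ < 1 := by
          rw [hz, ← div_eq_mul_inv, div_lt_one (by positivity)]
          linarith
    obtain ⟨w, hw⟩ : ∃ w, w + S (R w) = y := by
      let u := Units.oneSub _ hn
      refine ⟨(u⁻¹ : (H →L[ℂ] H)ˣ).1 y, ?_⟩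
      have := congrArg (fun T : H →L[ℂ] H => T y) u.mul_inv
      simpa [u, Units.val_oneSub] using this
    obtain ⟨hm, hw'⟩ := hR.1 w
    refine ⟨⟨R w, hd hm⟩, ?_⟩
    rw [h ⟨R w, hm⟩]
    change A ⟨R w, hm⟩ + S (R w) - z • R w = y
    rw [add_sub_right_comm, hw', hw]
  refine isSelfAdjoint_of_surjective ((‖S‖ + 1 : ℝ) * Complex.I) (fun x y => ?_)
    (hsurj _ ?_) (hsurj _ ?_)
  · have hx := h ⟨x, hd' x.2⟩
    have hy := h ⟨y, hd' y.2⟩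
    change A' x = _ at hx
    change A' y = _ at hy
    rw [hx, hy, inner_add_left, inner_add_right, hS]
    congr 1
    exact hA.inner_apply_left ⟨x, hd' x.2⟩ ⟨y, hd' y.2⟩
  · rw [Complex.im_ofReal_mul, Complex.I_im, mul_one, abs_of_nonneg (by positivity)]
  · rw [Complex.conj_im, Complex.im_ofReal_mul, Complex.I_im, mul_one, abs_neg,
      abs_of_nonneg (by positivity)]

/-- Strong convergence of bounded perturbations implies strong convergence of the resolvents. -/
theorem tendsto_resolvent_of_tendsto {ι : Type*} {l : Filter ι} {A : ι → H →ₗ.[ℂ] H}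
    {B : H →ₗ.[ℂ] H} {S : ι → H →L[ℂ] H} {T : H →L[ℂ] H}
    (hA : ∀ᶠ i in l, IsSelfAdjoint (A i)) (hd : ∀ i, B.domain ≤ (A i).domain)
    (h : ∀ i (x : B.domain), A i ⟨x, hd i x.2⟩ = B x + (S i x - T x))
    (hS : ∀ x, Tendsto (fun i => S i x) l (𝓝 (T x))) {z : ℂ} (hz : z.im ≠ 0)
    {R : ι → H →L[ℂ] H} {R₀ : H →L[ℂ] H} (hR : ∀ᶠ i in l, IsResolvent (A i) z (R i))
    (hR₀ : IsResolvent B z R₀) (x : H) : Tendsto (fun i => R i x) l (𝓝 (R₀ x)) := by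
  obtain ⟨hm, hx⟩ := hR₀.1 x
  have h0 : Tendsto (fun i => |z.im|⁻¹ * ‖S i (R₀ x) - T (R₀ x)‖) l (𝓝 0) := by
    have := (((hS (R₀ x)).sub_const (T (R₀ x))).norm).const_mul (|z.im|⁻¹)
    simpa using this
  rw [tendsto_iff_norm_sub_tendsto_zero]
  refine squeeze_zero' (Eventually.of_forall fun i => norm_nonneg _) ?_ h0
  filter_upwards [hA, hR] with i hAi hRi
  -- Resolvent identity. The perturbation acts on the fixed vector `R₀ x` only, so strong
  -- convergence of `S i` suffices.
  have h1 : R i (x + (S i (R₀ x) - T (R₀ x))) = R₀ x := by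
    have := hRi.2 ⟨R₀ x, hd i hm⟩
    rw [h i ⟨R₀ x, hm⟩] at this
    rw [← hx]
    change R i (B ⟨R₀ x, hm⟩ + (S i (R₀ x) - T (R₀ x)) - z • R₀ x) = R₀ x at this
    convert this using 2
    rw [hx]
    nth_rewrite 1 [← hx]
    abel
  have h2 : R i x - R₀ x = -R i (S i (R₀ x) - T (R₀ x)) := by
    rw [map_add] at h1
    rw [sub_eq_iff_eq_add, neg_add_eq_sub]
    exact eq_sub_of_add_eq h1
  rw [h2, norm_neg]
  exact hRi.norm_apply_le hAi.inner_apply_left hz _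

end Abstract

/-! ## Direct sums -/

section DirectSum

/-- Dominated convergence in a Hilbert space direct sum. -/
theorem tendsto_lp_of_dominated {ι : Type*} {l : Filter ι} [l.IsCountablyGenerated]
    {G : ℕ → Type*} [∀ n, NormedAddCommGroup (G n)] {f : ι → lp G 2} {g b : lp G 2}
    (h : ∀ n, Tendsto (fun i => f i n) l (𝓝 (g n)))
    (hb : ∀ᶠ i in l, ∀ n, ‖f i n - g n‖ ≤ ‖b n‖) : Tendsto f l (𝓝 g) := by
  have hsq : ∀ u : lp G 2, ‖u‖ ^ 2 = ∑' n, ‖u n‖ ^ 2 := fun u => by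
    have := lp.norm_rpow_eq_tsum (p := 2) (by norm_num) u
    simpa using this
  have hsum : Summable fun n => ‖b n‖ ^ 2 := by
    have := (lp.memℓp b).summable (by norm_num)
    simpa using this
  have h0 : Tendsto (fun i => ∑' n, ‖f i n - g n‖ ^ 2) l (𝓝 (∑' _ : ℕ, (0 : ℝ))) := by
    refine tendsto_tsum_of_dominated_convergence hsum (fun n => ?_) ?_
    · have := (((h n).sub_const (g n)).norm).pow 2
      simpa using this
    · filter_upwards [hb] with i hi n
      rw [Real.norm_of_nonneg (by positivity)]
      exact pow_le_pow_left₀ (norm_nonneg _) (hi n) 2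
  rw [tendsto_iff_norm_sub_tendsto_zero]
  have h1 : Tendsto (fun i => ‖f i - g‖ ^ 2) l (𝓝 0) := by
    rw [tsum_zero] at h0
    exact h0.congr fun i => (hsq (f i - g)).symm
  have h2 := h1.sqrt
  simpa [Real.sqrt_sq] using h2

variable {G : ℕ → Type*} [∀ n, NormedAddCommGroup (G n)] [∀ n, InnerProductSpace ℂ (G n)]

theorem IsResolvent.directSum_apply {A : ∀ n, G n →ₗ.[ℂ] G n} {z : ℂ} {R : lp G 2 →L[ℂ] lp G 2}
    {S : ∀ n, G n →L[ℂ] G n} (hR : IsResolvent (directSum A) z R)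
    (hS : ∀ n, IsResolvent (A n) z (S n)) (x : lp G 2) (n : ℕ) : R x n = S n (x n) := by
  obtain ⟨h, hx⟩ := hR.1 x
  have h1 : A n ⟨R x n, h.choose n⟩ - z • R x n = x n := congrArg (fun y : lp G 2 => y n) hx
  rw [← h1]
  exact ((hS n).2 ⟨R x n, h.choose n⟩).symm

variable [∀ n, CompleteSpace (G n)]

/-- The component resolvents have the common bound `|Im z|⁻¹`, so `x n = R n (y n)` is square
summable; so is `A n (x n) = y n + z • x n`, which puts `x` in the domain. -/
theorem directSum_isSelfAdjoint {A : ∀ n, G n →ₗ.[ℂ] G n} (hA : ∀ n, IsSelfAdjoint (A n)) :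
    IsSelfAdjoint (directSum A) := by
  have hsurj : ∀ z : ℂ, z.im ≠ 0 → ∀ y : lp G 2,
      ∃ x : (directSum A).domain, directSum A x - z • (x : lp G 2) = y := by
    intro z hz y
    choose R hR using fun n => (hA n).exists_isResolvent hz
    have hx : Memℓp (fun n => R n (y n)) 2 := by
      refine ((lp.memℓp y).const_smul ((|z.im|⁻¹ : ℝ) : ℂ)).mono' fun n => ?_
      refine ((hR n).norm_apply_le (hA n).inner_apply_left hz (y n)).trans_eq ?_
      simp [norm_smul]
    let x : lp G 2 := ⟨fun n => R n (y n), hx⟩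
    have hAx : ∀ n, ∃ h : R n (y n) ∈ (A n).domain, A n ⟨R n (y n), h⟩ = y n + z • R n (y n) := by
      intro n
      obtain ⟨h, h'⟩ := (hR n).1 (y n)
      exact ⟨h, sub_eq_iff_eq_add.1 h'⟩
    choose hd hv using hAx
    have hmem : x ∈ (directSum A).domain := by
      refine ⟨hd, ?_⟩
      have e : (fun n => A n ⟨x n, hd n⟩) = fun n => (y + z • x) n := funext hv
      rw [e]
      exact lp.memℓp _
    refine ⟨⟨x, hmem⟩, ?_⟩
    ext n
    change A n ⟨R n (y n), _⟩ - z • R n (y n) = y n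
    rw [hv, add_sub_cancel_right]
  refine isSelfAdjoint_of_surjective Complex.I (fun x y => ?_) (hsurj _ (by simp))
    (hsurj _ (by simp))
  rw [lp.inner_eq_tsum, lp.inner_eq_tsum]
  exact tsum_congr fun n => (hA n).inner_apply_left ⟨x.1 n, x.2.choose n⟩ ⟨y.1 n, y.2.choose n⟩

/-- The convergence in the components need not be uniform in `n`: the resolvent bounds supply a
square-summable majorant. -/
theorem directSum_strongResolventConvergence {ι : Type*} {l : Filter ι} [l.IsCountablyGenerated]
    {A : ι → ∀ n, G n →ₗ.[ℂ] G n} {B : ∀ n, G n →ₗ.[ℂ] G n}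
    (hA : ∀ᶠ i in l, ∀ n, IsSelfAdjoint (A i n)) (hB : ∀ n, IsSelfAdjoint (B n))
    (h : ∀ (z : ℂ), z.im ≠ 0 → ∀ n (R : ι → G n →L[ℂ] G n) (S : G n →L[ℂ] G n),
      (∀ᶠ i in l, IsResolvent (A i n) z (R i)) → IsResolvent (B n) z S →
        ∀ x, Tendsto (fun i => R i x) l (𝓝 (S x))) :
    StrongResolventConvergence (fun i => directSum (A i)) l (directSum B) := by
  classical
  refine ⟨hA.mono fun i hi => directSum_isSelfAdjoint hi, directSum_isSelfAdjoint hB,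
    fun z hz => ?_⟩
  obtain ⟨S, hS⟩ := (directSum_isSelfAdjoint hB).exists_isResolvent hz
  -- Indices without self-adjointness get the value `0`; they are eventually absent along `l`.
  have hR : ∀ i, ∃ R : lp G 2 →L[ℂ] lp G 2, (∀ n, IsSelfAdjoint (A i n)) →
      IsResolvent (directSum (A i)) z R := by
    intro i
    by_cases hi : ∀ n, IsSelfAdjoint (A i n)
    · obtain ⟨R, hR⟩ := (directSum_isSelfAdjoint hi).exists_isResolvent hz
      exact ⟨R, fun _ => hR⟩
    · exact ⟨0, fun h => (hi h).elim⟩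
  choose R hR using hR
  refine ⟨R, S, hA.mono fun i hi => hR i hi, hS, fun x => ?_⟩
  have hRn : ∀ i n, ∃ Rn : G n →L[ℂ] G n, (∀ n, IsSelfAdjoint (A i n)) →
      IsResolvent (A i n) z Rn := by
    intro i n
    by_cases hi : ∀ n, IsSelfAdjoint (A i n)
    · obtain ⟨R, hR⟩ := (hi n).exists_isResolvent hz
      exact ⟨R, fun _ => hR⟩
    · exact ⟨0, fun h => (hi h).elim⟩
  choose Rn hRn using hRn
  choose Sn hSn using fun n => (hB n).exists_isResolvent hz
  refine tendsto_lp_of_dominated (b := ((|z.im|⁻¹ + |z.im|⁻¹ : ℝ) : ℂ) • x) (fun n => ?_) ?_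
  · rw [hS.directSum_apply hSn]
    refine (h z hz n (fun i => Rn i n) (Sn n) (hA.mono fun i hi => hRn i n hi) (hSn n)
      (x n)).congr' ?_
    filter_upwards [hA] with i hi
    rw [(hR i hi).directSum_apply fun n => hRn i n hi]
  · filter_upwards [hA] with i hi n
    rw [(hR i hi).directSum_apply fun n => hRn i n hi, hS.directSum_apply hSn, lp.coeFn_smul,
      Pi.smul_apply, norm_smul, Complex.norm_real, Real.norm_of_nonneg (by positivity), add_mul]
    exact (norm_sub_le _ _).trans (add_le_add
      ((hRn i n hi).norm_apply_le (hi n).inner_apply_left hz _)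
      ((hSn n).norm_apply_le (hB n).inner_apply_left hz _))

end DirectSum

/-! ## The free Hamiltonian -/

section FreeResolvent

open FourierTransform

variable (E : Type*) [NormedAddCommGroup E] [InnerProductSpace ℝ E] [FiniteDimensional ℝ E]
  [MeasurableSpace E] [BorelSpace E]

/-- The symbol `(1 + |ξ|²)⁻¹`. -/
def besselSymbol (ξ : E) : ℂ := ((1 + ‖ξ‖ ^ 2) ^ ((-2 : ℝ) / 2) : ℝ)

theorem hasTemperateGrowth_besselSymbol (E : Type*) [NormedAddCommGroup E]
    [InnerProductSpace ℝ E] : (besselSymbol E).HasTemperateGrowth := by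
  unfold besselSymbol
  fun_prop

theorem memLp_besselSymbol : MemLp (besselSymbol E) ⊤ (volume : Measure E) := by
  refine memLp_top_of_bound
    (hasTemperateGrowth_besselSymbol E).1.continuous.aestronglyMeasurable 1
    (ae_of_all _ fun ξ => ?_)
  rw [besselSymbol, Complex.norm_real, Real.norm_of_nonneg (by positivity)]
  exact Real.rpow_le_one_of_one_le_of_nonpos (by simp) (by norm_num)

variable {E}

/-- The operator `(1 - Δ / (2π)²)⁻¹` on `L²`. -/
def freeResolvent (y : Lp ℂ 2 (volume : Measure E)) : Lp ℂ 2 (volume : Measure E) :=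
  𝓕⁻ ((memLp_besselSymbol E).toLp • 𝓕 y : Lp ℂ 2 (volume : Measure E))

/-- Links the multiplier on `L²`, convenient for inner products and isometries, to the Bessel
potential through which Sobolev spaces are defined. -/
theorem freeResolvent_spec (y : Lp ℂ 2 (volume : Measure E)) :
    (freeResolvent y : 𝓢'(E, ℂ)) =
      TemperedDistribution.besselPotential E ℂ (-2) (y : 𝓢'(E, ℂ)) := by
  rw [freeResolvent, ← Lp.fourierInv_toTemperedDistribution_eq,
    Lp.toTemperedDistribution_smul_eq (hasTemperateGrowth_besselSymbol E),
    ← Lp.fourier_toTemperedDistribution_eq]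
  rfl

theorem inner_freeResolvent_left (y w : Lp ℂ 2 (volume : Measure E)) :
    ⟪freeResolvent y, w⟫_ℂ = ⟪y, freeResolvent w⟫_ℂ := by
  have h : ∀ u v : Lp ℂ 2 (volume : Measure E),
      ⟪((memLp_besselSymbol E).toLp • u : Lp ℂ 2 (volume : Measure E)), v⟫_ℂ =
        ⟪u, ((memLp_besselSymbol E).toLp • v : Lp ℂ 2 (volume : Measure E))⟫_ℂ := by
    intro u v
    rw [L2.inner_def, L2.inner_def]
    refine integral_congr_ae ?_
    filter_upwards [Lp.coeFn_lpSMul (r := 2) (memLp_besselSymbol E).toLp u,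
      Lp.coeFn_lpSMul (r := 2) (memLp_besselSymbol E).toLp v,
      (memLp_besselSymbol E).coeFn_toLp] with x h1 h2 h3
    rw [h1, h2, Pi.smul_apply', Pi.smul_apply', h3, inner_smul_left, inner_smul_right]
    simp [besselSymbol]
  rw [← Lp.inner_fourier_eq, ← Lp.inner_fourier_eq y, freeResolvent, freeResolvent,
    fourier_fourierInv_eq, fourier_fourierInv_eq, h]

/-- The Bessel potential of order `2` has symbol `1 + |ξ|²`, and with the Fourier kernel `e^{-2πi⟨x,
ξ⟩}` the Laplacian has symbol `-(2π)² |ξ|²`. -/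
theorem laplacian_eq_sub_besselPotential (f : 𝓢'(E, ℂ)) :
    Δ f = (((2 * Real.pi) ^ 2 : ℝ) : ℂ) •
      (f - TemperedDistribution.besselPotential E ℂ 2 f) := by
  have hg : (fun x : E => Complex.ofReal (‖x‖ ^ 2)).HasTemperateGrowth :=
    Function.Complex.hasTemperateGrowth_ofReal.comp (Function.hasTemperateGrowth_norm_sq E)
  have h : TemperedDistribution.besselPotential E ℂ 2 f =
      f + TemperedDistribution.fourierMultiplierCLM ℂ (fun x : E => Complex.ofReal (‖x‖ ^ 2)) f := by
    have e : (fun x : E => (((1 + ‖x‖ ^ 2) ^ ((2 : ℝ) / 2) : ℝ) : ℂ)) =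
        (fun _ => 1) + fun x : E => Complex.ofReal (‖x‖ ^ 2) := by
      ext x
      simp
    rw [TemperedDistribution.besselPotential, e,
      TemperedDistribution.fourierMultiplierCLM_apply,
      TemperedDistribution.smulLeftCLM_add (by fun_prop) hg]
    simp [TemperedDistribution.fourierMultiplierCLM_apply, FourierTransform.fourierInv_add]
  rw [h, TemperedDistribution.laplacian_eq_fourierMultiplierCLM, sub_add_cancel_left, smul_neg,
    neg_smul, Complex.coe_smul]

theorem freeResolvent_mem_domain (y : Lp ℂ 2 (volume : Measure E)) :
    freeResolvent y ∈ (laplacian E).domain :=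
  ⟨y, by rw [freeResolvent_spec]; simp⟩

theorem laplacian_freeResolvent (y : Lp ℂ 2 (volume : Measure E)) :
    laplacian E ⟨freeResolvent y, freeResolvent_mem_domain y⟩ =
      (((2 * Real.pi) ^ 2 : ℝ) : ℂ) • (freeResolvent y - y) := by
  apply toTemperedDistribution_injective
  rw [laplacian_spec, laplacian_eq_sub_besselPotential, toTemperedDistribution_smul, sub_eq_add_neg,
    sub_eq_add_neg, toTemperedDistribution_add, ← neg_one_smul ℂ y, toTemperedDistribution_smul,
    neg_one_smul]
  congr 3
  rw [freeResolvent_spec]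
  simp

/-- Membership in `H²` provides the `L²` function `(1 + |ξ|²) ψ̂` on the Fourier side. Statements
about the Laplacian thereby reduce to the bounded operator `freeResolvent`. -/
theorem exists_eq_freeResolvent {ψ : Lp ℂ 2 (volume : Measure E)}
    (hψ : ψ ∈ (laplacian E).domain) : ∃ y, ψ = freeResolvent y := by
  obtain ⟨y, hy⟩ := hψ
  refine ⟨y, toTemperedDistribution_injective E ?_⟩
  rw [freeResolvent_spec, ← hy]
  simp

theorem inner_laplacian_left (ψ φ : (laplacian E).domain) :
    ⟪laplacian E ψ, (φ : Lp ℂ 2 (volume : Measure E))⟫_ℂ =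
      ⟪(ψ : Lp ℂ 2 (volume : Measure E)), laplacian E φ⟫_ℂ := by
  obtain ⟨ψ, hψ⟩ := ψ
  obtain ⟨φ, hφ⟩ := φ
  obtain ⟨y, rfl⟩ := exists_eq_freeResolvent hψ
  obtain ⟨w, rfl⟩ := exists_eq_freeResolvent hφ
  rw [laplacian_freeResolvent, laplacian_freeResolvent, inner_smul_left, inner_smul_right,
    inner_sub_left, inner_sub_right, Complex.conj_ofReal, inner_freeResolvent_left y w]

theorem inner_neg_laplacian_left (ψ φ : (laplacian E).domain) :
    ⟪-laplacian E ψ, (φ : Lp ℂ 2 (volume : Measure E))⟫_ℂ =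
      ⟪(ψ : Lp ℂ 2 (volume : Measure E)), -laplacian E φ⟫_ℂ := by
  rw [inner_neg_left, inner_neg_right, inner_laplacian_left]

theorem freeResolvent_smul (c : ℂ) (y : Lp ℂ 2 (volume : Measure E)) :
    freeResolvent (c • y) = c • freeResolvent y := by
  apply toTemperedDistribution_injective
  rw [freeResolvent_spec, toTemperedDistribution_smul, toTemperedDistribution_smul, map_smul,
    freeResolvent_spec]

/-- Both sides are continuous in `y` and agree on the dense set of Schwartz functions. -/
theorem fourier_compMeasurePreserving (A : E ≃ₗᵢ[ℝ] E) (y : Lp ℂ 2 (volume : Measure E)) :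
    𝓕 (Lp.compMeasurePreservingₗᵢ ℂ A A.measurePreserving y) =
      Lp.compMeasurePreservingₗᵢ ℂ A A.measurePreserving (𝓕 y) := by
  refine DenseRange.induction_on (p := fun y : Lp ℂ 2 (volume : Measure E) =>
    𝓕 (Lp.compMeasurePreservingₗᵢ ℂ A A.measurePreserving y) =
      Lp.compMeasurePreservingₗᵢ ℂ A A.measurePreserving (𝓕 y))
    (SchwartzMap.denseRange_toLpCLM (p := 2) ENNReal.ofNat_ne_top) y ?_ fun f => ?_
  · exact isClosed_eq ((Lp.fourierTransformₗᵢ E ℂ).continuous.comp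
      (Lp.compMeasurePreservingₗᵢ ℂ A A.measurePreserving).continuous)
      ((Lp.compMeasurePreservingₗᵢ ℂ A A.measurePreserving).continuous.comp
        (Lp.fourierTransformₗᵢ E ℂ).continuous)
  · let U : 𝓢(E, ℂ) →L[ℂ] 𝓢(E, ℂ) :=
      SchwartzMap.compCLMOfContinuousLinearEquiv ℂ A.toContinuousLinearEquiv
    have hU : ∀ g : 𝓢(E, ℂ), Lp.compMeasurePreservingₗᵢ ℂ A A.measurePreserving (g.toLp 2) =
        (U g).toLp 2 := fun g => rfl
    rw [SchwartzMap.toLpCLM_apply, hU, SchwartzMap.toLp_fourier_eq, SchwartzMap.toLp_fourier_eq, hU]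
    congr 1
    ext ξ
    have := Real.fourier_comp_linearIsometry A f ξ
    simpa [U, SchwartzMap.fourier_coe] using this

/-- The symbol is radial. Applied to relabellings of particles, this keeps `freeResolvent` inside
the antisymmetric sector. -/
theorem freeResolvent_compMeasurePreserving (A : E ≃ₗᵢ[ℝ] E) (y : Lp ℂ 2 (volume : Measure E)) :
    freeResolvent (Lp.compMeasurePreservingₗᵢ ℂ A A.measurePreserving y) =
      Lp.compMeasurePreservingₗᵢ ℂ A A.measurePreserving (freeResolvent y) := by
  apply (Lp.fourierTransformₗᵢ E ℂ).injective
  change (𝓕 (freeResolvent _) : Lp ℂ 2 (volume : Measure E)) =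
    𝓕 (Lp.compMeasurePreservingₗᵢ ℂ A A.measurePreserving (freeResolvent y))
  rw [fourier_compMeasurePreserving, freeResolvent, freeResolvent, fourier_fourierInv_eq,
    fourier_fourierInv_eq, fourier_compMeasurePreserving]
  ext1
  have hA : MeasurePreserving A (volume : Measure E) volume := A.measurePreserving
  filter_upwards [Lp.coeFn_lpSMul (r := 2) (memLp_besselSymbol E).toLp
      (Lp.compMeasurePreservingₗᵢ ℂ A A.measurePreserving (𝓕 y)),
    hA.quasiMeasurePreserving.ae
      (Lp.coeFn_lpSMul (r := 2) (memLp_besselSymbol E).toLp (𝓕 y)),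
    Lp.coeFn_compMeasurePreserving (𝓕 y) hA,
    Lp.coeFn_compMeasurePreserving ((memLp_besselSymbol E).toLp • 𝓕 y :
      Lp ℂ 2 (volume : Measure E)) hA,
    (memLp_besselSymbol E).coeFn_toLp,
    hA.quasiMeasurePreserving.ae (memLp_besselSymbol E).coeFn_toLp] with x h1 h2 h3 h4 h5 h6
  refine h1.trans (Eq.trans ?_ h4.symm)
  rw [Function.comp_apply, h2, Pi.smul_apply', Pi.smul_apply', h5, h6]
  refine congrArg₂ _ ?_ h3
  simp [besselSymbol]

end FreeResolvent

/-! ### Compression to the antisymmetric subspace and self-adjointness in each sector -/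

section Compression

variable {H G : Type*} [NormedAddCommGroup H] [InnerProductSpace ℂ H] [NormedAddCommGroup G]
  [InnerProductSpace ℂ G]

theorem neg_smul_sub_add_smul (P : H →L[ℂ] G) (c : ℂ) {u w : H} {u' w' : G} (hu : P u = u')
    (hw : P w = w') : P (-(c • (u - w))) + c • u' = c • w' := by
  rw [map_neg, map_smul, map_sub, hu, hw, smul_sub, neg_sub, sub_add_cancel]

theorem inner_add_apply_left {S T : G →L[ℂ] G} (hS : ∀ x y, ⟪S x, y⟫_ℂ = ⟪x, S y⟫_ℂ)
    (hT : ∀ x y, ⟪T x, y⟫_ℂ = ⟪x, T y⟫_ℂ) (x y : G) : ⟪(S + T) x, y⟫_ℂ = ⟪x, (S + T) y⟫_ℂ := by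
  simp only [add_apply, inner_add_left, inner_add_right, hS, hT]

/-- If `A` differs from a symmetric operator `f` by a bounded symmetric operator and `f + c` is
surjective for some real `c ≠ 0`, then `A` is self-adjoint. -/
theorem isSelfAdjoint_of_eq_add [CompleteSpace G] {A : G →ₗ.[ℂ] G} {f : A.domain → G}
    {S : G →L[ℂ] G} (hA : ∀ x : A.domain, A x = f x + S x)
    (hS : ∀ x y, ⟪S x, y⟫_ℂ = ⟪x, S y⟫_ℂ)
    (hf : ∀ x y : A.domain, ⟪f x, (y : G)⟫_ℂ = ⟪(x : G), f y⟫_ℂ) (c : ℝ) (hc : c ≠ 0)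
    (hsurj : ∀ w : G, ∃ x : A.domain, f x + (c : ℂ) • (x : G) = (c : ℂ) • w) :
    IsSelfAdjoint A := by
  let A₀ : G →ₗ.[ℂ] G := ⟨A.domain, A.toFun - S.toLinearMap ∘ₗ A.domain.subtype⟩
  have h₀ : ∀ x : A.domain, A₀ x = f x := fun x => by
    change A x - S x = f x
    rw [hA, add_sub_cancel_right]
  have hs : ∀ y : G, ∃ x : A₀.domain, A₀ x - ((-c : ℝ) : ℂ) • (x : G) = y := fun y => by
    obtain ⟨x, hx⟩ := hsurj ((c : ℂ)⁻¹ • y)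
    refine ⟨x, ?_⟩
    rw [h₀, Complex.ofReal_neg, neg_smul, sub_neg_eq_add, hx,
      smul_inv_smul₀ (Complex.ofReal_ne_zero.2 hc)]
  -- The point `-c` is real, hence its own conjugate: one surjectivity statement serves for both
  -- ranges.
  have h : IsSelfAdjoint A₀ := isSelfAdjoint_of_surjective ((-c : ℝ) : ℂ)
    (fun x y => by rw [h₀, h₀, hf]) hs (by rwa [Complex.conj_ofReal])
  refine h.of_bounded_perturbation hS le_rfl le_rfl fun x => ?_
  rw [h₀]
  exact hA x

end Compression

theorem freeResolvent_mem_sector {d n : ℕ} {y : L2 d n} (hy : y ∈ Sector d n) :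
    freeResolvent y ∈ Sector d n := fun π => by
  rw [permute, ← freeResolvent_compMeasurePreserving]
  change freeResolvent (permute d π y) = _
  rw [hy π, freeResolvent_smul]

theorem inner_antisymm_left {d n : ℕ} (u : L2 d n) (φ : Sector d n) :
    ⟪antisymm d n u, φ⟫_ℂ = ⟪u, (φ : L2 d n)⟫_ℂ :=
  Submodule.inner_orthogonalProjectionOnto_eq_of_mem_right φ u

theorem inner_antisymm_right {d n : ℕ} (u : L2 d n) (φ : Sector d n) :
    ⟪φ, antisymm d n u⟫_ℂ = ⟪(φ : L2 d n), u⟫_ℂ :=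
  Submodule.inner_orthogonalProjectionOnto_eq_of_mem_left φ u

theorem inner_antisymm_comm {d n : ℕ} (φ ψ : Sector d n) {u v : L2 d n}
    (h : ⟪u, (ψ : L2 d n)⟫_ℂ = ⟪(φ : L2 d n), v⟫_ℂ) :
    ⟪antisymm d n u, ψ⟫_ℂ = ⟪φ, antisymm d n v⟫_ℂ :=
  (inner_antisymm_left u ψ).trans (h.trans (inner_antisymm_right v φ).symm)

theorem antisymm_coe {d n : ℕ} (φ : Sector d n) : antisymm d n (φ : L2 d n) = φ :=
  Submodule.orthogonalProjectionOnto_mem_subspace_eq_self φ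

theorem antisymm_of_mem {d n : ℕ} {u : L2 d n} (hu : u ∈ Sector d n) : antisymm d n u = ⟨u, hu⟩ :=
  antisymm_coe ⟨u, hu⟩

theorem inner_mulOp_left {d n : ℕ} {g : Conf d n → ℝ} (hg : MemLp g ⊤) (u v : L2 d n) :
    ⟪mulOp hg u, v⟫_ℂ = ⟪u, mulOp hg v⟫_ℂ := by
  rw [L2.inner_def, L2.inner_def]
  refine integral_congr_ae ?_
  filter_upwards [mulOp_coeFn hg u, mulOp_coeFn hg v] with x h1 h2
  rw [h1, h2, ← smul_eq_mul, ← smul_eq_mul, inner_smul_left, inner_smul_right,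
    Complex.conj_ofReal]

/-- The compression of an operator to the antisymmetric subspace. -/
def compress {d n : ℕ} (A : L2 d n →L[ℂ] L2 d n) : Sector d n →L[ℂ] Sector d n :=
  antisymm d n ∘L A ∘L (Sector d n).subtypeL

theorem inner_compress_right {d n : ℕ} (A : L2 d n →L[ℂ] L2 d n) (φ ψ : Sector d n) :
    ⟪φ, compress A ψ⟫_ℂ = ⟪(φ : L2 d n), A ψ⟫_ℂ :=
  inner_antisymm_right (A ψ) φ

theorem inner_compress_left {d n : ℕ} {A : L2 d n →L[ℂ] L2 d n}
    (hA : ∀ u v, ⟪A u, v⟫_ℂ = ⟪u, A v⟫_ℂ) (φ ψ : Sector d n) :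
    ⟪compress A φ, ψ⟫_ℂ = ⟪φ, compress A ψ⟫_ℂ :=
  inner_antisymm_comm φ ψ (hA _ _)

/-- Solves `(-Δ + (2π)²) ψ = (2π)² w` within the sector; the projection changes nothing because both
functions are antisymmetric. -/
theorem antisymm_neg_laplacian_freeResolvent {d n : ℕ} (w : Sector d n) :
    antisymm d n (-(laplacian (Conf d n) ⟨freeResolvent w, freeResolvent_mem_domain _⟩))
      + (((2 * Real.pi) ^ 2 : ℝ) : ℂ) •
        (⟨freeResolvent w, freeResolvent_mem_sector w.2⟩ : Sector d n) =
      (((2 * Real.pi) ^ 2 : ℝ) : ℂ) • w :=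
  (congrArg (fun u => antisymm d n (-u) + _) (laplacian_freeResolvent (w : L2 d n))).trans
    (neg_smul_sub_add_smul (antisymm d n) _ (antisymm_of_mem (freeResolvent_mem_sector w.2))
      (antisymm_coe w))

theorem inner_antisymm_neg_laplacian_left {d n : ℕ} (ψ φ : Sector d n)
    (hψ : (ψ : L2 d n) ∈ (laplacian (Conf d n)).domain)
    (hφ : (φ : L2 d n) ∈ (laplacian (Conf d n)).domain) :
    ⟪antisymm d n (-laplacian (Conf d n) ⟨ψ, hψ⟩), φ⟫_ℂ =
      ⟪ψ, antisymm d n (-laplacian (Conf d n) ⟨φ, hφ⟩)⟫_ℂ :=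
  inner_antisymm_comm ψ φ (inner_neg_laplacian_left ⟨(ψ : L2 d n), hψ⟩ ⟨(φ : L2 d n), hφ⟩)

theorem mem_domain_sectorHamiltonian {d n : ℕ} {V : Pos d → ℝ} {hV : MemLp V ⊤}
    {B : Sector d n →L[ℂ] Sector d n} {ψ : Sector d n} :
    ψ ∈ (sectorHamiltonian hV B).domain ↔ (ψ : L2 d n) ∈ (laplacian (Conf d n)).domain := Iff.rfl

/-- The kinetic energy part of `sectorHamiltonian`. -/
def kineticEnergy {d n : ℕ} {V : Pos d → ℝ} (hV : MemLp V ⊤) (B : Sector d n →L[ℂ] Sector d n)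
    (ψ : (sectorHamiltonian hV B).domain) : Sector d n :=
  antisymm d n (-laplacian (Conf d n) ⟨(ψ : Sector d n), mem_domain_sectorHamiltonian.1 ψ.2⟩)

theorem sectorHamiltonian_eq {d n : ℕ} {V : Pos d → ℝ} (hV : MemLp V ⊤)
    (B : Sector d n →L[ℂ] Sector d n) (ψ : (sectorHamiltonian hV B).domain) :
    sectorHamiltonian hV B ψ = kineticEnergy hV B ψ
      + (compress (mulOp (memLp_onePotential hV n)) + B : Sector d n →L[ℂ] Sector d n)
        (ψ : Sector d n) :=
  (congrArg (fun u => u + B ψ) ((antisymm d n).map_add _ _)).trans (add_assoc _ _ _)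

theorem inner_kineticEnergy_left {d n : ℕ} {V : Pos d → ℝ} (hV : MemLp V ⊤)
    (B : Sector d n →L[ℂ] Sector d n) (ψ φ : (sectorHamiltonian hV B).domain) :
    ⟪kineticEnergy hV B ψ, (φ : Sector d n)⟫_ℂ = ⟪(ψ : Sector d n), kineticEnergy hV B φ⟫_ℂ :=
  inner_antisymm_neg_laplacian_left (ψ : Sector d n) (φ : Sector d n)
    (mem_domain_sectorHamiltonian.1 ψ.2) (mem_domain_sectorHamiltonian.1 φ.2)

theorem exists_kineticEnergy_add_smul_eq {d n : ℕ} {V : Pos d → ℝ} (hV : MemLp V ⊤)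
    (B : Sector d n →L[ℂ] Sector d n) (w : Sector d n) :
    ∃ ψ : (sectorHamiltonian hV B).domain,
      kineticEnergy hV B ψ + (((2 * Real.pi) ^ 2 : ℝ) : ℂ) • (ψ : Sector d n) =
        (((2 * Real.pi) ^ 2 : ℝ) : ℂ) • w :=
  ⟨⟨⟨freeResolvent w, freeResolvent_mem_sector w.2⟩, freeResolvent_mem_domain _⟩,
    antisymm_neg_laplacian_freeResolvent w⟩

theorem sectorHamiltonian_isSelfAdjoint {d n : ℕ} {V : Pos d → ℝ} (hV : MemLp V ⊤)
    {B : Sector d n →L[ℂ] Sector d n} (hB : ∀ x y, ⟪B x, y⟫_ℂ = ⟪x, B y⟫_ℂ) :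
    IsSelfAdjoint (sectorHamiltonian hV B) :=
  isSelfAdjoint_of_eq_add (sectorHamiltonian_eq hV B)
    (inner_add_apply_left (inner_compress_left (inner_mulOp_left (memLp_onePotential hV n))) hB)
    (inner_kineticEnergy_left hV B) ((2 * Real.pi) ^ 2) (by positivity)
    (exists_kineticEnergy_add_smul_eq hV B)

/-! ## Annihilation operators -/

section Abstract

variable {H₁ H₂ H₃ : Type*} [NormedAddCommGroup H₁] [InnerProductSpace ℂ H₁] [CompleteSpace H₁]
  [NormedAddCommGroup H₂] [InnerProductSpace ℂ H₂] [CompleteSpace H₂]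
  [NormedAddCommGroup H₃] [InnerProductSpace ℂ H₃] [CompleteSpace H₃]

theorem inner_comp_adjoint_comp (S : H₂ →L[ℂ] H₃) (T : H₁ →L[ℂ] H₂) (φ ψ : H₃) :
    ⟪φ, (S ∘L T ∘L T.adjoint ∘L S.adjoint) ψ⟫_ℂ =
      ⟪T.adjoint (S.adjoint φ), T.adjoint (S.adjoint ψ)⟫_ℂ := by
  rw [ContinuousLinearMap.adjoint_inner_left, ContinuousLinearMap.adjoint_inner_left]
  rfl

theorem inner_ofReal_smul_smul {H : Type*} [NormedAddCommGroup H] [InnerProductSpace ℂ H] (c : ℝ)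
    (u v : H) :
    ⟪(c : ℂ) • u, (c : ℂ) • v⟫_ℂ = ((c * c : ℝ) : ℂ) * ⟪u, v⟫_ℂ := by
  rw [inner_smul_left, inner_smul_right, Complex.conj_ofReal, ← mul_assoc, Complex.ofReal_mul]

end Abstract

theorem coeFn_permute {d n : ℕ} (π : Equiv.Perm (Fin n)) (ψ : L2 d n) :
    permute d π ψ =ᵐ[volume] fun x => ψ (relabel d π x) :=
  Lp.coeFn_compMeasurePreserving ψ (relabel d π).measurePreserving

theorem coeFn_tensor {d n : ℕ} (f : OneParticle d) (ψ : L2 d n) :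
    tensor n f ψ =ᵐ[volume] fun x => f (split d n x).1 * ψ (split d n x).2 :=
  (memLp_tensor f ψ).coeFn_toLp

theorem permute_permute_symm {d n : ℕ} (π : Equiv.Perm (Fin n)) (ψ : L2 d n) :
    permute d π (permute d π.symm ψ) = ψ := by
  ext1
  filter_upwards [coeFn_permute π (permute d π.symm ψ),
    (relabel d π).measurePreserving.quasiMeasurePreserving.ae (coeFn_permute π.symm ψ)]
    with x h1 h2
  rw [h1, h2]
  congr 1
  ext i : 1
  simp [relabel_apply]

/-- `decomposeFin.symm (0, π)` fixes the first particle and permutes the others by `π`. -/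
theorem permute_tensor {d n : ℕ} (π : Equiv.Perm (Fin n)) (f : OneParticle d) (ψ : L2 d n) :
    permute d (Equiv.Perm.decomposeFin.symm (0, π)) (tensor n f ψ) =
      tensor n f (permute d π ψ) := by
  ext1
  have hs : ∀ᵐ x : Conf d (n + 1), permute d π ψ (split d n x).2 =
      ψ (relabel d π (split d n x).2) :=
    (measurePreserving_split d n).quasiMeasurePreserving.ae
      (Measure.quasiMeasurePreserving_snd.ae (coeFn_permute π ψ))
  filter_upwards [coeFn_permute (Equiv.Perm.decomposeFin.symm (0, π)) (tensor n f ψ),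
    (relabel d (Equiv.Perm.decomposeFin.symm (0, π))).measurePreserving.quasiMeasurePreserving.ae
      (coeFn_tensor f ψ), coeFn_tensor f (permute d π ψ), hs] with x h1 h2 h3 h4
  rw [h1, h2, h3, h4]
  have e1 : (split d n (relabel d (Equiv.Perm.decomposeFin.symm (0, π)) x)).1 =
      (split d n x).1 := by
    simp [split, relabel_apply]
  have e2 : (split d n (relabel d (Equiv.Perm.decomposeFin.symm (0, π)) x)).2 =
      relabel d π (split d n x).2 := by
    ext i : 1
    rw [relabel_apply]
    simp [split, relabel_apply, Equiv.Perm.decomposeFin_symm_apply_succ]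
  rw [e1, e2]

/-- Contraction of the first variable with `f`; the adjoint of the tensor product. -/
def contract {d : ℕ} (n : ℕ) (f : OneParticle d) : L2 d (n + 1) →L[ℂ] L2 d n :=
  (tensor n f).adjoint

theorem inner_contract_right {d n : ℕ} (f : OneParticle d) (χ : L2 d n) (ψ : L2 d (n + 1)) :
    ⟪χ, contract n f ψ⟫_ℂ = ⟪tensor n f χ, ψ⟫_ℂ :=
  (tensor n f).adjoint_inner_right χ ψ

/-- By duality with `permute_tensor`: a permutation of the remaining particles extends, with the
same sign, to all `n + 1`. -/
theorem contract_mem_sector {d n : ℕ} (f : OneParticle d) {ψ : L2 d (n + 1)}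
    (hψ : ψ ∈ Sector d (n + 1)) : contract n f ψ ∈ Sector d n := by
  intro π
  refine ext_inner_left ℂ fun χ => ?_
  rw [← permute_permute_symm π χ]
  generalize permute d π.symm χ = χ'
  rw [LinearIsometry.inner_map_map, inner_smul_right, inner_contract_right, inner_contract_right,
    ← permute_tensor,
    ← LinearIsometry.inner_map_map (permute d (Equiv.Perm.decomposeFin.symm (0, π))),
    hψ, inner_smul_right]
  congr 3
  simp

/-- The projection in the creation operator disappears from the adjoint, since contracting an
antisymmetric function leaves it antisymmetric. -/
theorem coe_annihilation {d n : ℕ} (f : OneParticle d) (ψ : Sector d (n + 1)) :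
    ((annihilation n f ψ : Sector d n) : L2 d n) =
      ((√(n + 1 : ℝ) : ℝ) : ℂ) • contract n f (ψ : L2 d (n + 1)) := by
  have h : annihilation n f ψ =
      ((√(n + 1 : ℝ) : ℝ) : ℂ) •
        (⟨contract n f (ψ : L2 d (n + 1)), contract_mem_sector f ψ.2⟩ : Sector d n) := by
    refine ext_inner_left ℂ fun χ => ?_
    refine ((creation n f).adjoint_inner_right χ ψ).trans
      (Eq.trans ?_ (inner_smul_right (𝕜 := ℂ) _ _ _).symm)
    refine (inner_smul_left (𝕜 := ℂ) (antisymm d (n + 1) (tensor n f (χ : L2 d n))) ψ _).trans ?_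
    rw [Complex.conj_ofReal]
    exact congrArg _ ((inner_antisymm_left _ _).trans (inner_contract_right f _ _).symm)
  rw [h]
  rfl

/-- Both creation operators move to the left as annihilation operators; each side then carries the
factor `√((n+2)(n+1))`. -/
theorem inner_quartic {d n : ℕ} (f g : OneParticle d) (φ ψ : Sector d (n + 2)) :
    ⟪φ, quartic f g (n + 2) ψ⟫_ℂ = ((n + 2) * (n + 1) : ℂ) *
      ⟪contract n g (contract (n + 1) f φ), contract n g (contract (n + 1) f ψ)⟫_ℂ := by
  have key : ∀ χ : Sector d (n + 2),
      ((annihilation n g (annihilation (n + 1) f χ) : Sector d n) : L2 d n) =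
        ((√((n + 2) * (n + 1) : ℝ) : ℝ) : ℂ) • contract n g (contract (n + 1) f χ) := fun χ => by
    rw [coe_annihilation, coe_annihilation, map_smul, smul_smul, ← Complex.ofReal_mul,
      ← Real.sqrt_mul (by positivity)]
    congr 3
    push_cast
    ring
  refine (inner_comp_adjoint_comp (creation (n + 1) f) (creation n g) φ ψ).trans ?_
  refine (congrArg₂ (fun u v : L2 d n => ⟪u, v⟫_ℂ) (key φ) (key ψ)).trans ?_
  refine (inner_ofReal_smul_smul _ _ _).trans (congrArg (fun c : ℂ => c * _) ?_)
  rw [Real.mul_self_sqrt (by positivity)]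
  push_cast
  rfl

/-! ## Smearing by averaged translations -/

section Smear

variable {E P : Type*} [NormedAddCommGroup E] [InnerProductSpace ℝ E] [FiniteDimensional ℝ E]
  [MeasurableSpace E] [BorelSpace E]

/-- `(τ_v ψ)(x) = ψ(x + v)`. -/
def translate (v : E) : Lp ℂ 2 (volume : Measure E) →ₗᵢ[ℂ] Lp ℂ 2 (volume : Measure E) :=
  Lp.compMeasurePreservingₗᵢ ℂ (fun x => x + v) (measurePreserving_add_right volume v)

theorem coeFn_translate (v : E) (ψ : Lp ℂ 2 (volume : Measure E)) :
    translate v ψ =ᵐ[volume] fun x => ψ (x + v) :=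
  Lp.coeFn_compMeasurePreserving ψ (measurePreserving_add_right volume v)

theorem continuous_translate (ψ : Lp ℂ 2 (volume : Measure E)) :
    Continuous fun v : E => translate v ψ := by
  let g : C(E, C(E, E)) := ContinuousMap.curry ⟨fun p : E × E => p.2 + p.1, by fun_prop⟩
  exact Continuous.compMeasurePreservingLp (f := fun _ : E => ψ) (g := fun v => g v)
    continuous_const g.continuous (fun v => measurePreserving_add_right volume v)
    ENNReal.ofNat_ne_top

theorem translate_zero (ψ : Lp ℂ 2 (volume : Measure E)) : translate 0 ψ = ψ := by
  ext1
  filter_upwards [coeFn_translate 0 ψ] with x hx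
  rw [hx, add_zero]

theorem translate_neg_translate (v : E) (ψ : Lp ℂ 2 (volume : Measure E)) :
    translate v (translate (-v) ψ) = ψ := by
  ext1
  filter_upwards [coeFn_translate v (translate (-v) ψ),
    (measurePreserving_add_right volume v).quasiMeasurePreserving.ae (coeFn_translate (-v) ψ)]
    with x h1 h2
  rw [h1, h2, add_neg_cancel_right]

theorem inner_translate_left (v : E) (ψ φ : Lp ℂ 2 (volume : Measure E)) :
    ⟪translate v ψ, φ⟫_ℂ = ⟪ψ, translate (-v) φ⟫_ℂ := by
  nth_rewrite 1 [← translate_neg_translate v φ]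
  exact LinearIsometry.inner_map_map _ _ _

variable [NormedAddCommGroup P] [NormedSpace ℝ P] [MeasureSpace P] [BorelSpace P]

/-- The Fubini hypothesis for `coeFn_smear`. An `L²` function need not be integrable globally, hence
the set `s` of finite measure. -/
theorem integrable_mul_translate_prod [SFinite (volume : Measure P)] {w : P → ℝ}
    (hw : Integrable w) (c : P →L[ℝ] E) (ψ : Lp ℂ 2 (volume : Measure E)) {s : Set E}
    (hs : volume s < ⊤) :
    Integrable (fun q : P × E => (w q.1 : ℂ) * ψ (q.2 + c q.1))
      ((volume : Measure P).prod (volume.restrict s)) := by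
  have hfin : IsFiniteMeasure ((volume : Measure E).restrict s) := ⟨by simpa using hs⟩
  have hψ : StronglyMeasurable fun q : P × E => ψ (q.2 + c q.1) :=
    (Lp.stronglyMeasurable ψ).comp_measurable
      (by fun_prop : Continuous fun q : P × E => q.2 + c q.1).measurable
  have hm : AEStronglyMeasurable (fun q : P × E => (w q.1 : ℂ) * ψ (q.2 + c q.1))
      ((volume : Measure P).prod (volume.restrict s)) :=
    hw.ofReal.1.comp_fst.mul hψ.aestronglyMeasurable
  have hsq : ∀ v, Integrable fun x => ‖ψ (x + c v)‖ ^ 2 := fun v =>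
    ((memLp_two_iff_integrable_sq_norm (Lp.aestronglyMeasurable ψ)).1
      (Lp.memLp ψ)).comp_add_right (c v)
  -- Bounds the `L¹` norm on `s` by its volume plus the squared `L²` norm, uniformly in the
  -- translation.
  have hle : ∀ a : ℝ, a ≤ 1 + a ^ 2 := fun a => by nlinarith [sq_nonneg (a - 1), sq_nonneg a]
  have hint : ∀ v, Integrable (fun x => ψ (x + c v)) (volume.restrict s) := fun v => by
    refine ((integrable_const (1 : ℝ)).add (hsq v).restrict).mono'
      (hψ.comp_measurable measurable_prodMk_left).aestronglyMeasurable (ae_of_all _ fun x => ?_)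
    exact hle _
  rw [integrable_prod_iff hm]
  refine ⟨ae_of_all _ fun v => (hint v).const_mul (w v : ℂ), ?_⟩
  refine (hw.norm.mul_const (volume.real s + ∫ x, ‖ψ x‖ ^ 2)).mono'
    hm.norm.integral_prod_right' (ae_of_all _ fun v => ?_)
  rw [Real.norm_of_nonneg (integral_nonneg fun _ => norm_nonneg _)]
  simp only [norm_mul, Complex.norm_real]
  rw [integral_const_mul]
  refine mul_le_mul_of_nonneg_left ?_ (norm_nonneg _)
  calc ∫ x in s, ‖ψ (x + c v)‖ ≤ ∫ x in s, (1 + ‖ψ (x + c v)‖ ^ 2) :=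
        integral_mono (hint v).norm ((integrable_const _).add (hsq v).restrict) fun x => hle _
    _ = volume.real s + ∫ x in s, ‖ψ (x + c v)‖ ^ 2 := by
        rw [integral_add (integrable_const _) (hsq v).restrict]
        simp
    _ ≤ volume.real s + ∫ x, ‖ψ (x + c v)‖ ^ 2 := by
        exact add_le_add le_rfl
          (setIntegral_le_integral (hsq v) (ae_of_all _ fun x => sq_nonneg _))
    _ = _ := by rw [integral_add_right_eq_self (fun x => ‖ψ x‖ ^ 2)]

variable [SecondCountableTopology P]

theorem integrable_smul_translate {w : P → ℝ} (hw : Integrable w) (c : P →L[ℝ] E)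
    (ψ : Lp ℂ 2 (volume : Measure E)) :
    Integrable fun v => (w v : ℂ) • translate (c v) ψ := by
  have hm : AEStronglyMeasurable (fun v => translate (c v) ψ) (volume : Measure P) :=
    ((continuous_translate ψ).comp c.continuous).aestronglyMeasurable
  refine (hw.norm.mul_const ‖ψ‖).mono' (hw.ofReal (𝕜 := ℂ) |>.1.fun_smul hm)
    (ae_of_all _ fun v => ?_)
  rw [norm_smul, LinearIsometry.norm_map, Complex.norm_real]

/-- The average of the translates `τ_{c v} ψ` with weight `w v`. -/
def smear {w : P → ℝ} (hw : Integrable w) (c : P →L[ℝ] E) :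
    Lp ℂ 2 (volume : Measure E) →L[ℂ] Lp ℂ 2 (volume : Measure E) :=
  LinearMap.mkContinuous
    { toFun := fun ψ => ∫ v, (w v : ℂ) • translate (c v) ψ
      map_add' := fun ψ φ => by
        rw [← integral_add (integrable_smul_translate hw c ψ) (integrable_smul_translate hw c φ)]
        simp only [map_add, smul_add]
      map_smul' := fun a ψ => by
        rw [RingHom.id_apply, ← integral_smul]
        simp only [map_smul, smul_comm a] } (∫ v, ‖w v‖) fun ψ => by
      refine (norm_integral_le_integral_norm _).trans_eq ?_
      simp only [norm_smul, LinearIsometry.norm_map, Complex.norm_real]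
      rw [integral_mul_const]

theorem smear_apply {w : P → ℝ} (hw : Integrable w) (c : P →L[ℝ] E)
    (ψ : Lp ℂ 2 (volume : Measure E)) :
    smear hw c ψ = ∫ v, (w v : ℂ) • translate (c v) ψ := rfl

theorem norm_smear_apply_le {w : P → ℝ} (hw : Integrable w) (c : P →L[ℝ] E)
    (ψ : Lp ℂ 2 (volume : Measure E)) : ‖smear hw c ψ‖ ≤ (∫ v, ‖w v‖) * ‖ψ‖ :=
  (smear hw c).le_of_opNorm_le (LinearMap.mkContinuous_norm_le _
    (integral_nonneg fun _ => norm_nonneg _) _) ψ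

theorem inner_smear_right {w : P → ℝ} (hw : Integrable w) (c : P →L[ℝ] E)
    (ψ φ : Lp ℂ 2 (volume : Measure E)) :
    ⟪ψ, smear hw c φ⟫_ℂ = ∫ v, (w v : ℂ) * ⟪ψ, translate (c v) φ⟫_ℂ := by
  rw [smear_apply, ← integral_inner (integrable_smul_translate hw c φ)]
  simp only [inner_smul_right]

/-- The adjoint of translation by `v` is translation by `-v`, and the weight is even and real. -/
theorem inner_smear_left [(volume : Measure P).IsNegInvariant] {w : P → ℝ} (hw : Integrable w)
    (heven : ∀ v, w (-v) = w v) (c : P →L[ℝ] E) (ψ φ : Lp ℂ 2 (volume : Measure E)) :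
    ⟪smear hw c ψ, φ⟫_ℂ = ⟪ψ, smear hw c φ⟫_ℂ := by
  rw [← inner_conj_symm, inner_smear_right, inner_smear_right, ← integral_conj,
    ← integral_neg_eq_self]
  refine integral_congr_ae (ae_of_all _ fun v => ?_)
  simp only [map_mul, Complex.conj_ofReal, heven, inner_conj_symm, map_neg]
  rw [inner_translate_left, neg_neg]

/-- An approximate identity with `σ` in the displacement only: the weight stays fixed, so dominated
convergence with majorant `‖w v‖ ‖ψ‖` and strong continuity of translations suffice. -/
theorem tendsto_smear {w : P → ℝ} (hw : Integrable w) (h1 : ∫ v, w v = 1) (c : P →L[ℝ] E)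
    (ψ : Lp ℂ 2 (volume : Measure E)) :
    Tendsto (fun σ : ℝ => smear hw (σ • c) ψ) (𝓝 0) (𝓝 ψ) := by
  have h : ψ = ∫ v, (w v : ℂ) • translate ((0 : P →L[ℝ] E) v) ψ := by
    simp only [zero_apply, translate_zero]
    rw [integral_smul_const, integral_complex_ofReal, h1, Complex.ofReal_one, one_smul]
  nth_rewrite 2 [h]
  refine tendsto_integral_filter_of_dominated_convergence (fun v => ‖w v‖ * ‖ψ‖)
    (Eventually.of_forall fun σ => (integrable_smul_translate hw (σ • c) ψ).1)
    (Eventually.of_forall fun σ => ae_of_all _ fun v => ?_) (hw.norm.mul_const _)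
    (ae_of_all _ fun v => ?_)
  · rw [norm_smul, LinearIsometry.norm_map, Complex.norm_real]
  · have hc : Continuous fun σ : ℝ => (w v : ℂ) • translate (σ • c v) ψ :=
      Continuous.const_smul (M := ℂ) ((continuous_translate ψ).comp
        (continuous_id.smul (continuous_const (y := c v)))) (w v : ℂ)
    simpa using hc.tendsto 0

/-- The pointwise formula for `smear`. -/
theorem coeFn_smear [SFinite (volume : Measure P)] {w : P → ℝ} (hw : Integrable w)
    (c : P →L[ℝ] E) (ψ : Lp ℂ 2 (volume : Measure E)) :
    smear hw c ψ =ᵐ[volume] fun x => ∫ v, (w v : ℂ) * ψ (x + c v) := by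
  refine ae_eq_of_forall_setIntegral_eq_of_sigmaFinite (fun s hs hμ => ?_) (fun s hs hμ => ?_)
    fun s hs hμ => ?_
  · have : IsFiniteMeasure ((volume : Measure E).restrict s) := ⟨by simpa using hμ⟩
    exact ((Lp.memLp (smear hw c ψ)).restrict s).integrable (by norm_num)
  · exact (integrable_mul_translate_prod hw c ψ hμ).integral_prod_right
  · have h1 := L2.inner_indicatorConstLp_one (𝕜 := ℂ) hs hμ.ne (smear hw c ψ)
    rw [← h1, inner_smear_right, ← integral_integral_swap (f := fun v x => (w v : ℂ) * ψ (x + c v))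
      (integrable_mul_translate_prod hw c ψ hμ)]
    refine integral_congr_ae (ae_of_all _ fun v => ?_)
    simp only
    rw [integral_const_mul, L2.inner_indicatorConstLp_one (𝕜 := ℂ) hs hμ.ne]
    exact congrArg _ (integral_congr_ae (ae_restrict_of_ae (coeFn_translate (c v) ψ)))

end Smear

/-! ## The first two particles -/

/-- `((x₁, x₂), (x₃, …)) ↦ (x₁, x₂, x₃, …)`. -/
def join (d n : ℕ) : ((Pos d × Pos d) × Conf d n) →ₗ[ℝ] Conf d (n + 2) where
  toFun q := WithLp.toLp 2 (Fin.cons q.1.1 (Fin.cons q.1.2 fun i => q.2 i))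
  map_add' q r := by
    ext i : 1
    refine Fin.cases ?_ (fun j => Fin.cases ?_ (fun k => ?_) j) i <;> simp
  map_smul' c q := by
    ext i : 1
    refine Fin.cases ?_ (fun j => Fin.cases ?_ (fun k => ?_) j) i <;> simp

theorem continuous_join (d n : ℕ) : Continuous (join d n) := by
  refine (PiLp.continuous_toLp 2 _).comp (continuous_pi fun i => ?_)
  refine Fin.cases ?_ (fun j => Fin.cases ?_ (fun k => ?_) j) i
  · exact continuous_fst.fst
  · exact continuous_fst.snd
  · exact (PiLp.continuous_apply 2 _ k).comp continuous_snd

/-- `(x₁, x₂, x₃, …) ↦ ((x₁, x₂), (x₃, …))`. -/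
def unjoin (d n : ℕ) : Conf d (n + 2) ≃ᵐ (Pos d × Pos d) × Conf d n where
  toFun x := ((x 0, x 1), WithLp.toLp 2 fun i => x i.succ.succ)
  invFun := join d n
  left_inv x := by
    ext i : 1
    refine Fin.cases ?_ (fun j => Fin.cases ?_ (fun k => ?_) j) i <;> simp [join]
  right_inv q := by
    simp [join]
  measurable_toFun := by
    have h : Continuous fun x : Conf d (n + 2) =>
      ((x 0, x 1), (WithLp.toLp 2 fun i => x i.succ.succ : Conf d n)) := by fun_prop
    exact h.measurable
  measurable_invFun := (continuous_join d n).measurable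

theorem unjoin_apply {d n : ℕ} (x : Conf d (n + 2)) : unjoin d n x =
    (((split d (n + 1) x).1, (split d n (split d (n + 1) x).2).1),
      (split d n (split d (n + 1) x).2).2) := rfl

theorem unjoin_symm_apply {d n : ℕ} (q : (Pos d × Pos d) × Conf d n) :
    (unjoin d n).symm q = join d n q := rfl

theorem measurePreserving_unjoin (d n : ℕ) : MeasurePreserving (unjoin d n) :=
  ((measurePreserving_prodAssoc (volume : Measure (Pos d)) (volume : Measure (Pos d))
    (volume : Measure (Conf d n))).symm _).comp
    (((MeasurePreserving.id _).prod (measurePreserving_split d n)).comp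
      (measurePreserving_split d (n + 1)))

/-- The inclusion of the first two particles. -/
def firstTwo (d n : ℕ) : (Pos d × Pos d) →L[ℝ] Conf d (n + 2) :=
  ⟨join d n ∘ₗ LinearMap.inl ℝ (Pos d × Pos d) (Conf d n),
    (continuous_join d n).comp (continuous_id.prodMk continuous_const)⟩

theorem join_add {d n : ℕ} (p v : Pos d × Pos d) (z : Conf d n) :
    join d n (p + v, z) = join d n (p, z) + firstTwo d n v := by
  change _ = join d n (p, z) + join d n (v, 0)
  rw [← map_add]
  exact congrArg _ (Prod.ext rfl (add_zero z).symm)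

/-! ## Gaussian weights -/

theorem isAddHaarMeasure_volume_pair (d : ℕ) :
    (volume : Measure (Pos d × Pos d)).IsAddHaarMeasure :=
  inferInstanceAs ((volume : Measure (Pos d)).prod volume).IsAddHaarMeasure

attribute [local instance] isAddHaarMeasure_volume_pair

theorem integral_gaussian_one (d : ℕ) : ∫ v : Pos d, gaussian 1 0 v = 1 := by
  have h := GaussianFourier.integral_rexp_neg_mul_sq_norm (V := Pos d) (b := 1 / 2) (by norm_num)
  have e : ∀ v : Pos d, gaussian 1 0 v =
      1 / (2 * Real.pi) ^ ((d : ℝ) / 2) * Real.exp (-(1 / 2) * ‖v‖ ^ 2) := fun v => by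
    rw [gaussian, sub_zero]
    congr 2
    · norm_num
    · ring
  simp only [e]
  rw [integral_const_mul, h, finrank_euclideanSpace_fin, one_div_mul_eq_div, div_div_eq_mul_div,
    div_one, mul_comm Real.pi]
  exact div_self (by positivity)

theorem gaussian_neg {d : ℕ} (v : Pos d) : gaussian 1 0 (-v) = gaussian 1 0 v := by
  simp [gaussian]

theorem gaussian_scale {d : ℕ} {σ : ℝ} (hσ : 0 < σ) (x v : Pos d) :
    σ ^ d * gaussian σ x (x + σ • v) = gaussian 1 0 v := by
  have h1 : (2 * Real.pi * σ ^ 2) ^ ((d : ℝ) / 2) = (2 * Real.pi) ^ ((d : ℝ) / 2) * σ ^ d := by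
    rw [Real.mul_rpow (by positivity) (by positivity), ← Real.rpow_natCast σ 2,
      ← Real.rpow_mul hσ.le,
      ← Real.rpow_natCast σ d]
    congr 2
    push_cast
    ring
  rw [gaussian, gaussian, h1, add_sub_cancel_left, norm_smul, Real.norm_of_nonneg hσ.le, sub_zero,
    one_pow, mul_one, mul_one, mul_pow]
  have h2 : -(σ ^ 2 * ‖v‖ ^ 2) / (2 * σ ^ 2) = -‖v‖ ^ 2 / 2 := by
    field_simp
  rw [h2]
  field_simp

/-- The product of two standard Gaussians. -/
def pairWeight (d : ℕ) (v : Pos d × Pos d) : ℝ := gaussian 1 0 v.1 * gaussian 1 0 v.2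

theorem integrable_pairWeight (d : ℕ) : Integrable (pairWeight d) := by
  have h : Integrable fun v : Pos d => gaussian 1 0 v :=
    Integrable.of_integral_ne_zero (by rw [integral_gaussian_one]; exact one_ne_zero)
  exact h.mul_prod h

theorem integral_pairWeight (d : ℕ) : ∫ v, pairWeight d v = 1 := by
  have h := integral_prod_mul (μ := (volume : Measure (Pos d))) (ν := (volume : Measure (Pos d)))
    (gaussian 1 0) (gaussian 1 0)
  rw [integral_gaussian_one, one_mul] at h
  exact h

theorem pairWeight_neg {d : ℕ} (v : Pos d × Pos d) : pairWeight d (-v) = pairWeight d v := by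
  rw [pairWeight, Prod.fst_neg, Prod.snd_neg, gaussian_neg, gaussian_neg, pairWeight]

/-- Substitute `q = p + σ v`: the Jacobian `σ^{2d}` is absorbed by the two normalizations
(`gaussian_scale`), and `σ` moves from the weight to the argument of `F`. -/
theorem integral_gaussian_mul {d : ℕ} {σ : ℝ} (hσ : 0 < σ) (p : Pos d × Pos d)
    (F : Pos d × Pos d → ℂ) :
    ∫ q : Pos d × Pos d, ((gaussian σ p.1 q.1 * gaussian σ p.2 q.2 : ℝ) : ℂ) * F q =
      ∫ v, (pairWeight d v : ℂ) * F (p + σ • v) := by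
  have h := Measure.integral_comp_smul (volume : Measure (Pos d × Pos d))
    (fun q : Pos d × Pos d =>
      ((gaussian σ p.1 (p + q).1 * gaussian σ p.2 (p + q).2 : ℝ) : ℂ) * F (p + q)) σ
  rw [integral_add_left_eq_self (μ := (volume : Measure (Pos d × Pos d)))
    (fun q : Pos d × Pos d => ((gaussian σ p.1 q.1 * gaussian σ p.2 q.2 : ℝ) : ℂ) * F q) p,
    Module.finrank_prod, finrank_euclideanSpace_fin, abs_of_pos (by positivity),
    Complex.real_smul, Complex.ofReal_inv, eq_comm, inv_mul_eq_iff_eq_mul₀ (by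
      exact Complex.ofReal_ne_zero.2 (by positivity)), ← integral_const_mul] at h
  rw [h]
  refine integral_congr_ae (ae_of_all _ fun v => ?_)
  simp only
  rw [pairWeight, ← gaussian_scale hσ p.1 v.1, ← gaussian_scale hσ p.2 v.2, ← mul_assoc,
    ← Complex.ofReal_mul]
  congr 2
  simp only [Prod.fst_add, Prod.snd_add, Prod.smul_fst, Prod.smul_snd]
  ring

/-! ## The kernel of two contractions -/

theorem coeFn_tensor_tensor {d n : ℕ} (f g : OneParticle d) (χ : L2 d n) :
    tensor (n + 1) f (tensor n g χ) =ᵐ[volume] fun x =>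
      f (unjoin d n x).1.1 * g (unjoin d n x).1.2 * χ (unjoin d n x).2 := by
  have h : ∀ᵐ x : Conf d (n + 2), tensor n g χ (split d (n + 1) x).2 =
      g (split d n (split d (n + 1) x).2).1 * χ (split d n (split d (n + 1) x).2).2 :=
    (measurePreserving_split d (n + 1)).quasiMeasurePreserving.ae
      (Measure.quasiMeasurePreserving_snd.ae (coeFn_tensor g χ))
  filter_upwards [coeFn_tensor f (tensor n g χ), h] with x h1 h2
  rw [h1, h2, unjoin_apply, mul_assoc]

theorem inner_comp_join_ae {d n : ℕ} (f g : OneParticle d) (χ : L2 d n) (ψ : L2 d (n + 2)) :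
    (fun q => ⟪tensor (n + 1) f (tensor n g χ) (join d n q), ψ (join d n q)⟫_ℂ) =ᵐ[volume]
      fun q => starRingEnd ℂ (χ q.2) *
        (starRingEnd ℂ (f q.1.1 * g q.1.2) * ψ (join d n q)) := by
  filter_upwards [(measurePreserving_unjoin d n).symm.quasiMeasurePreserving.ae
    (coeFn_tensor_tensor f g χ)] with q hq
  rw [MeasurableEquiv.apply_symm_apply, unjoin_symm_apply] at hq
  rw [hq, RCLike.inner_apply, map_mul]
  ring

theorem integrable_contract_kernel {d n : ℕ} (f g : OneParticle d) (χ : L2 d n)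
    (ψ : L2 d (n + 2)) :
    Integrable fun q : (Pos d × Pos d) × Conf d n => starRingEnd ℂ (χ q.2) *
      (starRingEnd ℂ (f q.1.1 * g q.1.2) * ψ (join d n q)) := by
  refine Integrable.congr ?_ (inner_comp_join_ae f g χ ψ)
  exact (measurePreserving_unjoin d n).symm.integrable_comp_of_integrable
    (L2.integrable_inner (𝕜 := ℂ) (tensor (n + 1) f (tensor n g χ)) ψ)

theorem inner_contract_contract {d n : ℕ} (f g : OneParticle d) (χ : L2 d n)
    (ψ : L2 d (n + 2)) :
    ⟪χ, contract n g (contract (n + 1) f ψ)⟫_ℂ =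
      ∫ z, starRingEnd ℂ (χ z) *
        ∫ p : Pos d × Pos d, starRingEnd ℂ (f p.1 * g p.2) * ψ (join d n (p, z)) := by
  rw [inner_contract_right, inner_contract_right, L2.inner_def,
    ← (measurePreserving_unjoin d n).symm.integral_comp' (fun x =>
      ⟪tensor (n + 1) f (tensor n g χ) x, ψ x⟫_ℂ)]
  refine (integral_congr_ae (inner_comp_join_ae f g χ ψ)).trans ?_
  refine (integral_prod_symm _ (integrable_contract_kernel f g χ ψ)).trans ?_
  simp only [integral_const_mul]

/-- `contract` is defined as an adjoint; testing against indicators of sets of finite measure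
recovers its integral kernel. -/
theorem coeFn_contract_contract {d n : ℕ} (f g : OneParticle d) (ψ : L2 d (n + 2)) :
    contract n g (contract (n + 1) f ψ) =ᵐ[volume] fun z =>
      ∫ p : Pos d × Pos d, starRingEnd ℂ (f p.1 * g p.2) * ψ (join d n (p, z)) := by
  set K : Conf d n → ℂ := fun z =>
    ∫ p : Pos d × Pos d, starRingEnd ℂ (f p.1 * g p.2) * ψ (join d n (p, z)) with hK
  have hind : ∀ (s : Set (Conf d n)) (hs : MeasurableSet s) (hμ : volume s ≠ ⊤),
      (fun z => starRingEnd ℂ (indicatorConstLp 2 hs hμ (1 : ℂ) z) * K z) =ᵐ[volume]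
        s.indicator K := fun s hs hμ => by
    filter_upwards [indicatorConstLp_coeFn (p := 2) (hs := hs) (hμs := hμ) (c := (1 : ℂ))]
      with z hz
    rw [hz]
    by_cases hzs : z ∈ s <;> simp [hzs]
  refine ae_eq_of_forall_setIntegral_eq_of_sigmaFinite (fun s hs hμ => ?_) (fun s hs hμ => ?_)
    fun s hs hμ => ?_
  · have : IsFiniteMeasure ((volume : Measure (Conf d n)).restrict s) := ⟨by simpa using hμ⟩
    exact ((Lp.memLp (contract n g (contract (n + 1) f ψ))).restrict s).integrable (by norm_num)
  · refine (integrable_indicator_iff hs).1 (Integrable.congr ?_ (hind s hs hμ.ne))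
    have h := (integrable_contract_kernel f g (indicatorConstLp 2 hs hμ.ne (1 : ℂ))
      ψ).integral_prod_right
    simpa only [integral_const_mul] using h
  · rw [← L2.inner_indicatorConstLp_one (𝕜 := ℂ) hs hμ.ne, inner_contract_contract,
      integral_congr_ae (hind s hs hμ.ne), integral_indicator hs]

/-! ### Contraction with two Gaussians as an average over translations -/

theorem coeFn_gaussianL2 {d : ℕ} {σ : ℝ} (hσ : 0 < σ) (x : Pos d) :
    gaussianL2 σ x =ᵐ[volume] fun y => (gaussian σ x y : ℂ) := by
  rw [gaussianL2, dif_pos hσ]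
  exact (memLp_gaussian hσ x).coeFn_toLp

/-- The average of `ψ` over the translates of the first two particles, with Gaussian weight. -/
def smearPair (d n : ℕ) (σ : ℝ) : L2 d (n + 2) →L[ℂ] L2 d (n + 2) :=
  smear (integrable_pairWeight d) (σ • firstTwo d n)

theorem coeFn_contract_gaussian {d n : ℕ} {σ : ℝ} (hσ : 0 < σ) (ψ : L2 d (n + 2))
    (p : Pos d × Pos d) :
    contract n (gaussianL2 σ p.2) (contract (n + 1) (gaussianL2 σ p.1) ψ) =ᵐ[volume] fun z =>
      ∫ v, (pairWeight d v : ℂ) * ψ (join d n (p, z) + σ • firstTwo d n v) := by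
  refine (coeFn_contract_contract _ _ ψ).trans (ae_of_all _ fun z => ?_)
  have h : ∫ q : Pos d × Pos d, starRingEnd ℂ (gaussianL2 σ p.1 q.1 * gaussianL2 σ p.2 q.2) *
      ψ (join d n (q, z)) = ∫ q : Pos d × Pos d,
        ((gaussian σ p.1 q.1 * gaussian σ p.2 q.2 : ℝ) : ℂ) * ψ (join d n (q, z)) := by
    refine integral_congr_ae ?_
    filter_upwards [Measure.quasiMeasurePreserving_fst.ae (coeFn_gaussianL2 hσ p.1),
      Measure.quasiMeasurePreserving_snd.ae (coeFn_gaussianL2 hσ p.2)] with q h1 h2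
    rw [h1, h2, ← Complex.ofReal_mul, Complex.conj_ofReal]
  refine h.trans ((integral_gaussian_mul hσ p fun q => ψ (join d n (q, z))).trans ?_)
  simp only [join_add, map_smul]

theorem ae_smearPair {d n : ℕ} (σ : ℝ) (ψ : L2 d (n + 2)) :
    (fun q => smearPair d n σ ψ (join d n q)) =ᵐ[volume] fun q =>
      ∫ v, (pairWeight d v : ℂ) * ψ (join d n q + σ • firstTwo d n v) :=
  (measurePreserving_unjoin d n).symm.quasiMeasurePreserving.ae
    (coeFn_smear (integrable_pairWeight d) (σ • firstTwo d n) ψ)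

/-- Identifies annihilation of Gaussians at the two points of `p` with evaluation of one `L²`
function at first coordinates `p`. The slices of an `L²` class are determined for almost every `p`
only, which is enough under the integral over `p`. -/
theorem coeFn_contract_gaussian_smearPair {d n : ℕ} {σ : ℝ} (hσ : 0 < σ) (ψ : L2 d (n + 2)) :
    ∀ᵐ p : Pos d × Pos d, contract n (gaussianL2 σ p.2) (contract (n + 1) (gaussianL2 σ p.1) ψ)
      =ᵐ[volume] fun z => smearPair d n σ ψ (join d n (p, z)) := by
  filter_upwards [Measure.ae_ae_of_ae_prod (ae_smearPair σ ψ)] with p hp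
  exact (coeFn_contract_gaussian hσ ψ p).trans (EventuallyEq.symm hp)

theorem isNegInvariant_volume_pair (d : ℕ) :
    (volume : Measure (Pos d × Pos d)).IsNegInvariant :=
  Measure.IsAddHaarMeasure.isNegInvariant_of_regular _

attribute [local instance] isNegInvariant_volume_pair

/-! ## Matrix elements of the interactions -/

theorem memLp_restrictedPair {d n : ℕ} {W : Pos d → ℝ} (hW : MemLp W ⊤) {Λ : Set (Pos d)}
    (hΛ : NullMeasurableSet Λ) {k l : Fin n} (hkl : k ≠ l) :
    MemLp (fun x : Conf d n => restrictedPair W Λ (x k) (x l)) ⊤ := by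
  have hs : NullMeasurableSet
      ((fun x : Conf d n => x k) ⁻¹' Λ ∩ (fun x : Conf d n => x l) ⁻¹' Λ) :=
    (hΛ.preimage (quasiMeasurePreserving_coord k)).inter
      (hΛ.preimage (quasiMeasurePreserving_coord l))
  have h := memLp_top_comp hW (quasiMeasurePreserving_coord_sub (d := d) hkl)
  have h2 : MemLp (((fun x : Conf d n => x k) ⁻¹' Λ ∩ (fun x : Conf d n => x l) ⁻¹' Λ).indicator
      fun x => W (x k - x l)) ⊤ :=
    ⟨h.1.indicator₀ hs, (eLpNorm_indicator_le _).trans_lt h.2⟩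
  exact h2

theorem inner_mulOp_ae {d n : ℕ} {g : Conf d n → ℝ} (hg : MemLp g ⊤) (φ ψ : L2 d n) :
    (fun x => ⟪φ x, mulOp hg ψ x⟫_ℂ) =ᵐ[volume] fun x => (g x : ℂ) * ⟪φ x, ψ x⟫_ℂ := by
  filter_upwards [mulOp_coeFn hg ψ] with x hx
  rw [hx, ← smul_eq_mul, inner_smul_right]

theorem integrable_mul_inner {d n : ℕ} {g : Conf d n → ℝ} (hg : MemLp g ⊤) (φ ψ : L2 d n) :
    Integrable fun x => (g x : ℂ) * ⟪φ x, ψ x⟫_ℂ :=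
  (L2.integrable_inner (𝕜 := ℂ) φ (mulOp hg ψ)).congr (inner_mulOp_ae hg φ ψ)

theorem inner_mulOp_right {d n : ℕ} {g : Conf d n → ℝ} (hg : MemLp g ⊤) (φ ψ : L2 d n) :
    ⟪φ, mulOp hg ψ⟫_ℂ = ∫ x, (g x : ℂ) * ⟪φ x, ψ x⟫_ℂ :=
  (L2.inner_def (𝕜 := ℂ) φ (mulOp hg ψ)).trans (integral_congr_ae (inner_mulOp_ae hg φ ψ))

/-- Multiplication by `W_Λ(x₁, x₂)`. -/
def pairOp {d : ℕ} {W : Pos d → ℝ} (hW : MemLp W ⊤) {Λ : Set (Pos d)}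
    (hΛ : NullMeasurableSet Λ) (n : ℕ) : L2 d (n + 2) →L[ℂ] L2 d (n + 2) :=
  mulOp (memLp_restrictedPair hW hΛ (zero_ne_one : (0 : Fin (n + 2)) ≠ 1))

theorem integrable_pairOp {d n : ℕ} {W : Pos d → ℝ} (hW : MemLp W ⊤) {Λ : Set (Pos d)}
    (hΛ : NullMeasurableSet Λ) (φ ψ : L2 d (n + 2)) :
    Integrable fun q : (Pos d × Pos d) × Conf d n => (restrictedPair W Λ q.1.1 q.1.2 : ℂ) *
      ⟪φ (join d n q), ψ (join d n q)⟫_ℂ :=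
  (measurePreserving_unjoin d n).symm.integrable_comp_of_integrable
    (integrable_mul_inner (memLp_restrictedPair hW hΛ (zero_ne_one : (0 : Fin (n + 2)) ≠ 1)) φ ψ)

theorem inner_pairOp {d n : ℕ} {W : Pos d → ℝ} (hW : MemLp W ⊤) {Λ : Set (Pos d)}
    (hΛ : NullMeasurableSet Λ) (φ ψ : L2 d (n + 2)) :
    ⟪φ, pairOp hW hΛ n ψ⟫_ℂ = ∫ p : Pos d × Pos d, (restrictedPair W Λ p.1 p.2 : ℂ) *
      ∫ z, ⟪φ (join d n (p, z)), ψ (join d n (p, z))⟫_ℂ := by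
  refine (inner_mulOp_right _ φ ψ).trans ?_
  rw [← (measurePreserving_unjoin d n).symm.integral_comp']
  refine (integral_prod _ (integrable_pairOp hW hΛ φ ψ)).trans ?_
  simp only [integral_const_mul]

theorem inner_contract_gaussian_ae {d n : ℕ} {σ : ℝ} (hσ : 0 < σ) (φ ψ : L2 d (n + 2)) :
    (fun p : Pos d × Pos d =>
      ⟪contract n (gaussianL2 σ p.2) (contract (n + 1) (gaussianL2 σ p.1) φ),
        contract n (gaussianL2 σ p.2) (contract (n + 1) (gaussianL2 σ p.1) ψ)⟫_ℂ) =ᵐ[volume]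
      fun p => ∫ z, ⟪smearPair d n σ φ (join d n (p, z)),
        smearPair d n σ ψ (join d n (p, z))⟫_ℂ := by
  filter_upwards [coeFn_contract_gaussian_smearPair hσ φ, coeFn_contract_gaussian_smearPair hσ ψ]
    with p h1 h2
  refine (L2.inner_def (𝕜 := ℂ) _ _).trans (integral_congr_ae ?_)
  filter_upwards [h1, h2] with z h3 h4
  rw [h3, h4]

theorem inner_smearPair_left {d n : ℕ} (σ : ℝ) (φ ψ : L2 d (n + 2)) :
    ⟪smearPair d n σ φ, ψ⟫_ℂ = ⟪φ, smearPair d n σ ψ⟫_ℂ :=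
  inner_smear_left (integrable_pairWeight d) pairWeight_neg _ φ ψ

theorem inner_ofReal_smul_conj_left {H : Type*} [NormedAddCommGroup H] [InnerProductSpace ℂ H]
    {G M : H → H} (hG : ∀ u v, ⟪G u, v⟫_ℂ = ⟪u, G v⟫_ℂ) (hM : ∀ u v, ⟪M u, v⟫_ℂ = ⟪u, M v⟫_ℂ)
    (c : ℝ) (u v : H) : ⟪(c : ℂ) • G (M (G u)), v⟫_ℂ = ⟪u, (c : ℂ) • G (M (G v))⟫_ℂ := by
  rw [inner_smul_left, inner_smul_right, Complex.conj_ofReal, hG, hM, hG]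

/-- Multiplication by `W_Λ(x₁, x₂)` for each pair of particles, between two averages. -/
def smearedPairOp {d : ℕ} {W : Pos d → ℝ} (hW : MemLp W ⊤) {Λ : Set (Pos d)}
    (hΛ : NullMeasurableSet Λ) (n : ℕ) (σ : ℝ) : L2 d (n + 2) →L[ℂ] L2 d (n + 2) :=
  (((n + 2) * (n + 1) / 2 : ℝ) : ℂ) • (smearPair d n σ ∘L pairOp hW hΛ n ∘L smearPair d n σ)

theorem smearedPairOp_apply {d n : ℕ} {W : Pos d → ℝ} (hW : MemLp W ⊤) {Λ : Set (Pos d)}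
    (hΛ : NullMeasurableSet Λ) (σ : ℝ) (u : L2 d (n + 2)) :
    smearedPairOp hW hΛ n σ u = (((n + 2) * (n + 1) / 2 : ℝ) : ℂ) •
      smearPair d n σ (pairOp hW hΛ n (smearPair d n σ u)) := rfl

theorem inner_smearedPairOp {d n : ℕ} {W : Pos d → ℝ} (hW : MemLp W ⊤) {Λ : Set (Pos d)}
    (hΛ : NullMeasurableSet Λ) (σ : ℝ) (u v : L2 d (n + 2)) :
    ⟪u, smearedPairOp hW hΛ n σ v⟫_ℂ = (((n + 2) * (n + 1) / 2 : ℝ) : ℂ) *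
      ⟪smearPair d n σ u, pairOp hW hΛ n (smearPair d n σ v)⟫_ℂ := by
  rw [smearedPairOp_apply, inner_smul_right, inner_smearPair_left]

theorem inner_smearedPairOp_left {d n : ℕ} {W : Pos d → ℝ} (hW : MemLp W ⊤) {Λ : Set (Pos d)}
    (hΛ : NullMeasurableSet Λ) (σ : ℝ) (u v : L2 d (n + 2)) :
    ⟪smearedPairOp hW hΛ n σ u, v⟫_ℂ = ⟪u, smearedPairOp hW hΛ n σ v⟫_ℂ :=
  inner_ofReal_smul_conj_left (inner_smearPair_left σ)
    (inner_mulOp_left (memLp_restrictedPair hW hΛ zero_ne_one)) _ u v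

/-- A product of strongly convergent operators converges strongly because the outer factor is
bounded uniformly in `σ`, by the `L¹` norm of the weight. -/
theorem tendsto_smearedPairOp {d n : ℕ} {W : Pos d → ℝ} (hW : MemLp W ⊤) {Λ : Set (Pos d)}
    (hΛ : NullMeasurableSet Λ) (u : L2 d (n + 2)) :
    Tendsto (fun σ => smearedPairOp hW hΛ n σ u) (𝓝 0)
      (𝓝 ((((n + 2) * (n + 1) / 2 : ℝ) : ℂ) • pairOp hW hΛ n u)) := by
  have hG : ∀ χ : L2 d (n + 2), Tendsto (fun σ => smearPair d n σ χ) (𝓝 0) (𝓝 χ) :=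
    tendsto_smear (integrable_pairWeight d) (integral_pairWeight d) (firstTwo d n)
  have h1 := ((pairOp hW hΛ n).continuous.tendsto _).comp (hG u)
  have h3 : Tendsto (fun σ => smearPair d n σ (pairOp hW hΛ n (smearPair d n σ u)) -
      smearPair d n σ (pairOp hW hΛ n u)) (𝓝 0) (𝓝 0) := by
    refine squeeze_zero_norm (fun σ => ?_) (by
      simpa using (h1.sub_const (pairOp hW hΛ n u)).norm.const_mul (∫ v, ‖pairWeight d v‖))
    rw [← map_sub]
    exact norm_smear_apply_le _ _ _
  have h2 := h3.add (hG (pairOp hW hΛ n u))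
  simp only [sub_add_cancel, zero_add] at h2
  exact h2.const_smul _

/-- The smeared interaction as a compression. -/
def smearedSectorOp {d : ℕ} {W : Pos d → ℝ} (hW : MemLp W ⊤) {Λ : Set (Pos d)}
    (hΛ : NullMeasurableSet Λ) (σ : ℝ) : ∀ n : ℕ, Sector d n →L[ℂ] Sector d n
  | 0 => 0
  | 1 => 0
  | n + 2 => compress (smearedPairOp hW hΛ n σ)

theorem inner_quartic_gaussian_ae {d n : ℕ} (W : Pos d → ℝ) (Λ : Set (Pos d)) {σ : ℝ} (hσ : 0 < σ)
    (φ ψ : Sector d (n + 2)) :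
    (fun p : Pos d × Pos d => (restrictedPair W Λ p.1 p.2 : ℂ) *
        ⟪φ, quartic (gaussianL2 σ p.1) (gaussianL2 σ p.2) (n + 2) ψ⟫_ℂ) =ᵐ[volume]
      fun p => ((n + 2) * (n + 1) : ℂ) * ((restrictedPair W Λ p.1 p.2 : ℂ) *
        ∫ z, ⟪smearPair d n σ φ (join d n (p, z)), smearPair d n σ ψ (join d n (p, z))⟫_ℂ) := by
  filter_upwards [inner_contract_gaussian_ae hσ (φ : L2 d (n + 2)) ψ] with p hp
  refine (congrArg (fun c : ℂ => _ * c) (inner_quartic _ _ φ ψ)).trans ?_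
  rw [hp]
  ring

/-- The integral over `p` and the inner integral over the remaining particles recombine by Fubini
into one inner product. The `½` of the definition and the `(n+2)(n+1)` of `inner_quartic` give the
number of pairs. -/
theorem isSmearedInteraction_compress {d n : ℕ} {W : Pos d → ℝ} (hW : MemLp W ⊤)
    {Λ : Set (Pos d)} (hΛ : NullMeasurableSet Λ) {σ : ℝ} (hσ : 0 < σ) :
    IsSmearedInteraction W Λ σ (n + 2) (compress (smearedPairOp hW hΛ n σ)) := by
  intro φ ψ
  have h := inner_quartic_gaussian_ae W Λ hσ φ ψ
  refine ⟨Integrable.congr ?_ h.symm, ?_⟩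
  · have h2 := (integrable_pairOp hW hΛ (smearPair d n σ φ) (smearPair d n σ ψ)).integral_prod_left
    simp only [integral_const_mul] at h2
    exact h2.const_mul _
  · refine (inner_compress_right _ φ ψ).trans (Eq.trans ?_
      (congrArg (fun c : ℂ => 1 / 2 * c) (integral_congr_ae h)).symm)
    rw [integral_const_mul, ← inner_pairOp hW hΛ, inner_smearedPairOp]
    push_cast
    ring

theorem isSmearedInteraction_smearedSectorOp {d : ℕ} {W : Pos d → ℝ} (hW : MemLp W ⊤)
    {Λ : Set (Pos d)} (hΛ : NullMeasurableSet Λ) {σ : ℝ} (hσ : 0 < σ) (n : ℕ) :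
    IsSmearedInteraction W Λ σ n (smearedSectorOp hW hΛ σ n) :=
  match n with
  | 0 => fun φ ψ => by simp [quartic, smearedSectorOp]
  | 1 => fun φ ψ => by simp [quartic, smearedSectorOp]
  | _ + 2 => isSmearedInteraction_compress hW hΛ hσ

theorem isSmearedInteraction_smearedInteraction {d : ℕ} {W : Pos d → ℝ} (hW : MemLp W ⊤)
    {Λ : Set (Pos d)} (hΛ : NullMeasurableSet Λ) {σ : ℝ} (hσ : 0 < σ) (n : ℕ) :
    IsSmearedInteraction W Λ σ n (smearedInteraction W Λ σ n) := by
  have h : ∃ T, IsSmearedInteraction W Λ σ n T :=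
    ⟨_, isSmearedInteraction_smearedSectorOp hW hΛ hσ n⟩
  rw [smearedInteraction, dif_pos h]
  exact h.choose_spec

/-- Uniqueness of the weak integral replaces the chosen operator by the explicit one. -/
theorem smearedInteraction_eq {d : ℕ} {W : Pos d → ℝ} (hW : MemLp W ⊤)
    {Λ : Set (Pos d)} (hΛ : NullMeasurableSet Λ) {σ : ℝ} (hσ : 0 < σ) (n : ℕ) :
    smearedInteraction W Λ σ n = smearedSectorOp hW hΛ σ n :=
  (isSmearedInteraction_smearedInteraction hW hΛ hσ n).unique
    (isSmearedInteraction_smearedSectorOp hW hΛ hσ n)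

theorem inner_smearedSectorOp_left {d : ℕ} {W : Pos d → ℝ} (hW : MemLp W ⊤) {Λ : Set (Pos d)}
    (hΛ : NullMeasurableSet Λ) (σ : ℝ) (n : ℕ) (φ ψ : Sector d n) :
    ⟪smearedSectorOp hW hΛ σ n φ, ψ⟫_ℂ = ⟪φ, smearedSectorOp hW hΛ σ n ψ⟫_ℂ :=
  match n, φ, ψ with
  | 0, φ, ψ => (inner_zero_left (𝕜 := ℂ) ψ).trans (inner_zero_right (𝕜 := ℂ) φ).symm
  | 1, φ, ψ => (inner_zero_left (𝕜 := ℂ) ψ).trans (inner_zero_right (𝕜 := ℂ) φ).symm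
  | _ + 2, φ, ψ => inner_compress_left (inner_smearedPairOp_left hW hΛ σ) φ ψ

/-! ## The point interaction -/

theorem exists_perm_zero_one {n : ℕ} {k l : Fin (n + 2)} (hkl : k ≠ l) :
    ∃ π : Equiv.Perm (Fin (n + 2)), π 0 = k ∧ π 1 = l := by
  have h : Equiv.swap 0 k 1 ≠ k := fun h => by
    have := (Equiv.swap 0 k).injective (h.trans (Equiv.swap_apply_left 0 k).symm)
    exact one_ne_zero this
  -- The first swap sends `0` to `k`; the second sends the image of `1` to `l` and fixes `k`.
  refine ⟨Equiv.swap (Equiv.swap 0 k 1) l * Equiv.swap 0 k, ?_, ?_⟩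
  · rw [Equiv.Perm.mul_apply, Equiv.swap_apply_left, Equiv.swap_apply_of_ne_of_ne h.symm hkl]
  · rw [Equiv.Perm.mul_apply, Equiv.swap_apply_left]

theorem inner_relabel_ae {d n : ℕ} (φ ψ : Sector d n) (π : Equiv.Perm (Fin n)) :
    (fun x => ⟪(φ : L2 d n) (relabel d π x), (ψ : L2 d n) (relabel d π x)⟫_ℂ) =ᵐ[volume]
      fun x => ⟪(φ : L2 d n) x, (ψ : L2 d n) x⟫_ℂ := by
  have h : ∀ χ : Sector d n, ∀ᵐ x, (χ : L2 d n) (relabel d π x) =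
      ((Equiv.Perm.sign π : ℤ) : ℂ) * (χ : L2 d n) x := fun χ => by
    have e := χ.2 π
    filter_upwards [coeFn_permute π (χ : L2 d n),
      Lp.coeFn_smul ((Equiv.Perm.sign π : ℤ) : ℂ) (χ : L2 d n)] with x h1 h2
    rw [← h1, e, h2]
    rfl
  filter_upwards [h φ, h ψ] with x h1 h2
  rw [h1, h2, ← smul_eq_mul, ← smul_eq_mul, inner_smul_left, inner_smul_right]
  rcases Int.units_eq_one_or (Equiv.Perm.sign π) with e | e <;> simp [e]

/-- Relabel by a permutation taking `(0, 1)` to `(k, l)`; the two signs cancel in the inner product.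
The ordered pair is moved as a whole, so `W` need not be even. -/
theorem integral_restrictedPair_eq {d n : ℕ} (W : Pos d → ℝ) (Λ : Set (Pos d))
    (φ ψ : Sector d (n + 2)) {k l : Fin (n + 2)} (hkl : k ≠ l) :
    ∫ x, (restrictedPair W Λ (x k) (x l) : ℂ) *
        ⟪(φ : L2 d (n + 2)) x, (ψ : L2 d (n + 2)) x⟫_ℂ =
      ∫ x, (restrictedPair W Λ (x 0) (x 1) : ℂ) *
        ⟪(φ : L2 d (n + 2)) x, (ψ : L2 d (n + 2)) x⟫_ℂ := by
  obtain ⟨π, rfl, rfl⟩ := exists_perm_zero_one hkl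
  rw [← (relabel d π).measurePreserving.integral_comp
    (relabel d π).toHomeomorph.measurableEmbedding (fun x : Conf d (n + 2) =>
      (restrictedPair W Λ (x 0) (x 1) : ℂ) * ⟪(φ : L2 d (n + 2)) x, (ψ : L2 d (n + 2)) x⟫_ℂ)]
  refine integral_congr_ae ?_
  filter_upwards [inner_relabel_ae φ ψ π] with x hx
  rw [hx, relabel_apply, relabel_apply]

theorem sum_card_Ioi (n : ℕ) :
    ((∑ k : Fin (n + 2), (Finset.Ioi k).card : ℕ) : ℂ) = (((n + 2) * (n + 1) / 2 : ℝ) : ℂ) := by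
  have h : ∀ m : ℕ, 2 * ∑ k : Fin (m + 1), (Finset.Ioi k).card = (m + 1) * m := fun m => by
    simp only [Fin.card_Ioi, Nat.add_sub_cancel]
    rw [Fin.sum_univ_eq_sum_range (fun k => m - k), ← Finset.sum_range_reflect]
    have e : ∀ j ∈ Finset.range (m + 1), m - (m + 1 - 1 - j) = j := fun j hj => by
      have := Finset.mem_range.1 hj
      omega
    rw [Finset.sum_congr rfl e, mul_comm 2, Finset.sum_range_id_mul_two, Nat.add_sub_cancel]
  have h2 : (2 : ℂ) * ((∑ k : Fin (n + 2), (Finset.Ioi k).card : ℕ) : ℂ) = (n + 2) * (n + 1) := by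
    have := congrArg (Nat.cast : ℕ → ℂ) (h (n + 1))
    push_cast at this ⊢
    rw [this]
    ring
  push_cast
  rw [← Nat.cast_sum, ← h2, mul_div_cancel_left₀ _ two_ne_zero]

/-- All pairs contribute equally between antisymmetric functions. The two multiplication operators
themselves may differ on the full `L²` space. -/
theorem inner_mulOp_pairPotential {d n : ℕ} {W : Pos d → ℝ} (hW : MemLp W ⊤) {Λ : Set (Pos d)}
    (hΛ : NullMeasurableSet Λ) (φ ψ : Sector d (n + 2)) :
    ⟪(φ : L2 d (n + 2)), mulOp (memLp_pairPotential hW hΛ (n + 2)) ψ⟫_ℂ =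
      (((n + 2) * (n + 1) / 2 : ℝ) : ℂ) * ⟪(φ : L2 d (n + 2)), pairOp hW hΛ n ψ⟫_ℂ := by
  have hint : ∀ k : Fin (n + 2), ∀ l ∈ Finset.Ioi k, Integrable fun x : Conf d (n + 2) =>
      (restrictedPair W Λ (x k) (x l) : ℂ) *
        ⟪(φ : L2 d (n + 2)) x, (ψ : L2 d (n + 2)) x⟫_ℂ := fun k l hl =>
    integrable_mul_inner (memLp_restrictedPair hW hΛ (Finset.mem_Ioi.1 hl).ne) _ _
  rw [pairOp, inner_mulOp_right, inner_mulOp_right, ← sum_card_Ioi]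
  simp only [pairPotential, Complex.ofReal_sum, Finset.sum_mul]
  rw [integral_finsetSum _ fun k _ => integrable_finsetSum _ (hint k), Nat.cast_sum,
    Finset.sum_mul]
  refine Finset.sum_congr rfl fun k _ => ?_
  rw [integral_finsetSum _ (hint k), Finset.sum_congr rfl fun l hl =>
    integral_restrictedPair_eq W Λ φ ψ (Finset.mem_Ioi.1 hl).ne, Finset.sum_const, nsmul_eq_mul]

theorem pointInteraction_eq {d n : ℕ} {W : Pos d → ℝ} (hW : MemLp W ⊤) {Λ : Set (Pos d)}
    (hΛ : NullMeasurableSet Λ) (ψ : Sector d (n + 2)) :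
    pointInteraction hW hΛ (n + 2) ψ =
      antisymm d (n + 2) ((((n + 2) * (n + 1) / 2 : ℝ) : ℂ) • pairOp hW hΛ n ψ) :=
  ext_inner_left ℂ fun φ =>
    (inner_antisymm_right (mulOp (memLp_pairPotential hW hΛ (n + 2)) ψ) φ).trans
      ((inner_mulOp_pairPotential hW hΛ φ ψ).trans
        ((inner_smul_right (𝕜 := ℂ) _ _ _).symm.trans (inner_antisymm_right _ φ).symm))

theorem pointInteraction_eq_zero {d n : ℕ} {W : Pos d → ℝ} (hW : MemLp W ⊤) {Λ : Set (Pos d)}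
    (hΛ : NullMeasurableSet Λ) (hn : Subsingleton (Fin n)) (ψ : Sector d n) :
    pointInteraction hW hΛ n ψ = 0 := by
  refine ext_inner_left ℂ fun φ => ?_
  refine (inner_antisymm_right (mulOp (memLp_pairPotential hW hΛ n) ψ) φ).trans
    (Eq.trans ?_ (inner_zero_right (𝕜 := ℂ) φ).symm)
  rw [inner_mulOp_right]
  have h : ∀ k : Fin n, Finset.Ioi k = ∅ := fun k =>
    Finset.eq_empty_of_forall_notMem fun l hl => (Finset.mem_Ioi.1 hl).ne (Subsingleton.elim _ _)
  simp [pairPotential, h]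

/-- The explicit operator makes sense for every real `σ`, so the limit is two-sided here; positivity
matters only when it is identified with the weak integral. -/
theorem tendsto_smearedSectorOp {d : ℕ} {W : Pos d → ℝ} (hW : MemLp W ⊤) {Λ : Set (Pos d)}
    (hΛ : NullMeasurableSet Λ) (n : ℕ) (ψ : Sector d n) :
    Tendsto (fun σ => smearedSectorOp hW hΛ σ n ψ) (𝓝 0) (𝓝 (pointInteraction hW hΛ n ψ)) :=
  match n, ψ with
  | 0, ψ => (pointInteraction_eq_zero hW hΛ inferInstance ψ).symm ▸ tendsto_const_nhds
  | 1, ψ => (pointInteraction_eq_zero hW hΛ inferInstance ψ).symm ▸ tendsto_const_nhds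
  | n + 2, ψ => (pointInteraction_eq hW hΛ ψ).symm ▸
      ((antisymm d (n + 2)).continuous.tendsto _).comp
        (tendsto_smearedPairOp hW hΛ (ψ : L2 d (n + 2)))

/-! ### Resolvent convergence and self-adjointness in each sector -/

theorem sectorHamiltonian_sub {d n : ℕ} {V : Pos d → ℝ} (hV : MemLp V ⊤)
    (B B' : Sector d n →L[ℂ] Sector d n) (x : (sectorHamiltonian hV B').domain) :
    sectorHamiltonian hV B ⟨x, x.2⟩ = sectorHamiltonian hV B' x +
      (B (x : Sector d n) - B' (x : Sector d n)) :=
  (add_add_sub_cancel _ _ _).symm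

theorem tendsto_sectorHamiltonian_resolvent {ι : Type*} {l : Filter ι} {d n : ℕ} {V : Pos d → ℝ}
    (hV : MemLp V ⊤) {S : ι → Sector d n →L[ℂ] Sector d n} {T : Sector d n →L[ℂ] Sector d n}
    (hS : ∀ᶠ i in l, IsSelfAdjoint (sectorHamiltonian hV (S i)))
    (hST : ∀ x, Tendsto (fun i => S i x) l (𝓝 (T x))) {z : ℂ} (hz : z.im ≠ 0)
    {R : ι → Sector d n →L[ℂ] Sector d n} {R₀ : Sector d n →L[ℂ] Sector d n}
    (hR : ∀ᶠ i in l, IsResolvent (sectorHamiltonian hV (S i)) z (R i))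
    (hR₀ : IsResolvent (sectorHamiltonian hV T) z R₀) (x : Sector d n) :
    Tendsto (fun i => R i x) l (𝓝 (R₀ x)) :=
  tendsto_resolvent_of_tendsto hS (fun _ => le_rfl) (fun i x => sectorHamiltonian_sub hV (S i) T x)
    hST hz hR hR₀ x

theorem isSelfAdjoint_sectorHamiltonian_smeared {d : ℕ} {V W : Pos d → ℝ} (hV : MemLp V ⊤)
    (hW : MemLp W ⊤) {Λ : Set (Pos d)} (hΛ : NullMeasurableSet Λ) {σ : ℝ} (hσ : 0 < σ) (n : ℕ) :
    IsSelfAdjoint (sectorHamiltonian hV (smearedInteraction W Λ σ n)) := by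
  rw [smearedInteraction_eq hW hΛ hσ]
  exact sectorHamiltonian_isSelfAdjoint hV (inner_smearedSectorOp_left hW hΛ σ n)

theorem isSelfAdjoint_sectorHamiltonian_point {d : ℕ} {V W : Pos d → ℝ} (hV : MemLp V ⊤)
    (hW : MemLp W ⊤) {Λ : Set (Pos d)} (hΛ : NullMeasurableSet Λ) (n : ℕ) :
    IsSelfAdjoint (sectorHamiltonian hV (pointInteraction hW hΛ n)) :=
  sectorHamiltonian_isSelfAdjoint hV
    (inner_compress_left (inner_mulOp_left (memLp_pairPotential hW hΛ n)))

theorem tendsto_smearedInteraction {d : ℕ} {W : Pos d → ℝ} (hW : MemLp W ⊤) {Λ : Set (Pos d)}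
    (hΛ : NullMeasurableSet Λ) (n : ℕ) (ψ : Sector d n) :
    Tendsto (fun σ => smearedInteraction W Λ σ n ψ) (𝓝[>] 0)
      (𝓝 (pointInteraction hW hΛ n ψ)) := by
  refine ((tendsto_smearedSectorOp hW hΛ n ψ).mono_left nhdsWithin_le_nhds).congr' ?_
  filter_upwards [self_mem_nhdsWithin] with σ hσ
  rw [smearedInteraction_eq hW hΛ hσ]

end FermiGas

end

open FermiGas in
theorem theoremA1 (d : ℕ) (hd : 1 ≤ d) (V W : Pos d → ℝ)
    (hV : MemLp V ⊤ (volume : Measure (Pos d))) (hW : MemLp W ⊤ (volume : Measure (Pos d)))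
    (Λ : Set (Pos d)) (hΛ : NullMeasurableSet Λ (volume : Measure (Pos d))) :
    -- the weak integrals defining the smeared interactions exist as bounded operators
    (∀ σ : ℝ, 0 < σ → ∀ n : ℕ, IsSmearedInteraction W Λ σ n (smearedInteraction W Λ σ n)) ∧
    -- the Hamiltonians are self-adjoint
    (∀ σ : ℝ, 0 < σ → IsSelfAdjoint (smearedHamiltonian hV W Λ σ)) ∧
    IsSelfAdjoint (pointHamiltonian hV hW hΛ) ∧
    -- strong resolvent convergence as `σ ↓ 0`
    StrongResolventConvergence (fun σ : ℝ => smearedHamiltonian hV W Λ σ) (𝓝[>] 0)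
      (pointHamiltonian hV hW hΛ) := by
  -- One neighbourhood works for all `n`, as the direct sum requires: every `σ > 0` is admissible.
  have hs : ∀ᶠ σ : ℝ in 𝓝[>] 0,
      ∀ n, IsSelfAdjoint (sectorHamiltonian hV (smearedInteraction W Λ σ n)) := by
    filter_upwards [self_mem_nhdsWithin] with σ hσ n
    exact isSelfAdjoint_sectorHamiltonian_smeared hV hW hΛ hσ n
  have hp := isSelfAdjoint_sectorHamiltonian_point hV hW hΛ
  refine ⟨fun σ hσ n => isSmearedInteraction_smearedInteraction hW hΛ hσ n, fun σ hσ =>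
    directSum_isSelfAdjoint fun n => isSelfAdjoint_sectorHamiltonian_smeared hV hW hΛ hσ n,
    directSum_isSelfAdjoint hp, directSum_strongResolventConvergence hs hp ?_⟩
  intro z hz n R S hR hS x
  exact tendsto_sectorHamiltonian_resolvent hV (hs.mono fun σ h => h n)
    (tendsto_smearedInteraction hW hΛ n) hz hR hS x
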